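/- **Setting.** Let $d\in\{2,3\}$ and let $\Omega\subset\mathbb R^d$ be a bounded polyhedral domain: open, connected, equal to the interior of its closure, with $\overline\Omega$ the union of the closed simplices of a finite simplicial mesh $\mathcal T_h$ without hanging nodes. Let $k\ge 1$. Let $\mathcal F_h$ be the set of facets and $h_F$ the diameter of $F\in\mathcal F_h$. On an interior facet $F$ shared by $K^+$ and $K^-$ (labelled arbitrarily) let $n_F$ be the unit normal pointing from $K^+$ to $K^-$, $[\![\phi]\!]=\phi^+-\phi^-$ and $\{\!\!\{\phi\}\!\!\}=\tfrac12(\phi^++\phi^-)$; on a boundary facet let $n_F$ be the outer unit normal and $[\![\phi]\!]=\{\!\!\{\phi\}\!\!\}=\phi$. Let $\nabla_h$ and $\nabla_h\cdot$ be the elementwise gradient and divergence. Put $$V_h=\{v\in L^2(\Omega)^d: v|_K\in\mathbb P_k(K)^d\ \forall K\in\mathcal T_h\},\qquad Q_h=\{q\in L^2(\Omega): \textstyle\int_\Omega q\,dx=0,\ q|_K\in\mathbb P_{k-1}(K)\ \forall K\in\mathcal T_h\},$$ $$a_h(w,v)=\int_\Omega\nabla_hw:\nabla_hv\,dx+\sum_{F\in\mathcal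 F_h}\frac{\sigma}{h_F}\int_F[\![w]\!]\cdot[\![v]\!]\,ds-\sum_{F\in\mathcal F_h}\int_F\{\!\!\{\nabla w\}\!\!\}n_F\cdot[\![v]\!]\,ds-\sum_{F\in\mathcal F_h}\int_F[\![w]\!]\cdot\{\!\!\{\nabla v\}\!\!\}n_F\,ds,$$ $$b_h(w,q)=-\int_\Omega q\,\nabla_h\cdot w\,dx+\sum_{F\in\mathcal F_h}\int_F\{\!\!\{q\}\!\!\}\,[\![w]\!]\cdot n_F\,ds,$$ $$\|v\|_e^2=\|\nabla_hv\|_{L^2(\Omega)}^2+\sum_{F\in\mathcal F_h}\frac{\sigma}{h_F}\|[\![v]\!]\|_{L^2(F)}^2,\qquad |v|_{\mathrm{nj}}^2=\sum_{F\in\mathcal F_h}\frac1{h_F}\int_F([\![v]\!]\cdot n_F)^2\,ds .$$ Let $H_0(\mathrm{div};\Omega)$ be the space of $w\in L^2(\Omega)^d$ with weak divergence $\nabla\cdot w\in L^2(\Omega)$ and zero normal trace on $\partial\Omega$, that is, $\int_\Omega (w\cdot\nabla\phi+(\nabla\cdot w)\,\phi)\,dx=0$ for all $\phi\in C_c^\infty(\mathbb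 R^d)$. Put $$V_h^{\mathrm{div}}=\{v\in V_h: b_h(v,q)=0\ \forall q\in Q_h\},\qquad W_h=V_h\cap H_0(\mathrm{div};\Omega),$$ $$W_h^{\mathrm{div}}=\{w\in W_h: -\textstyle\int_\Omega q\,\nabla\cdot w\,dx=0\ \forall q\in Q_h\},\qquad R_h^\perp=\{v\in V_h^{\mathrm{div}}: a_h(v,w)=0\ \forall w\in W_h^{\mathrm{div}}\}.$$ The form $a_h$ is called coercive if there is $C_\sigma>0$ with $a_h(v,v)\ge C_\sigma\|v\|_e^2$ for all $v\in V_h$. **Corollary 3.7.** For the given mesh and degree $k$, the form $a_h$ is coercive for all sufficiently large $\sigma$. Moreover, for every $\sigma\ge1$ for which $a_h$ is coercive: 1. $R_h^\perp$ is a linear subspace of $V_h$, and $|\cdot|_{\mathrm{nj}}$ is a norm on it; 2. $R_h^\perp\cap H_0(\mathrm{div};\Omega)=\{0\}$. -/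

import Mathlib

open MeasureTheory
open scoped ContDiff

noncomputable section

namespace DGStokes

/-- A finite simplicial mesh without hanging nodes of `Ω ⊆ ℝ^d`. An element is stored through the
finite set `K` of its `d + 1` vertices; the closed simplex is `convexHull ℝ K`. -/
structure SimplicialMesh (d : ℕ) (Ω : Set (EuclideanSpace ℝ (Fin d))) where
  /-- the vertex sets of the elements -/
  cells : Finset (Finset (EuclideanSpace ℝ (Fin d)))
  card_eq : ∀ K ∈ cells, K.card = d + 1
  indep : ∀ K ∈ cells, AffineIndependent ℝ ((↑) : K → EuclideanSpace ℝ (Fin d))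
  /-- two elements meet exactly in the simplex spanned by their common vertices -/
  conforming : ∀ K ∈ cells, ∀ L ∈ cells,
    convexHull ℝ (K : Set (EuclideanSpace ℝ (Fin d))) ∩ convexHull ℝ (L : Set _) =
      convexHull ℝ ((K : Set (EuclideanSpace ℝ (Fin d))) ∩ (L : Set _))
  cover : ⋃ K ∈ cells, convexHull ℝ (K : Set (EuclideanSpace ℝ (Fin d))) = closure Ω

variable {d : ℕ} {Ω : Set (EuclideanSpace ℝ (Fin d))}

/-- The closed convex hull of the vertices, for elements as well as for facets. -/
abbrev hull (S : Finset (EuclideanSpace ℝ (Fin d))) : Set (EuclideanSpace ℝ (Fin d)) :=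
  convexHull ℝ (S : Set (EuclideanSpace ℝ (Fin d)))

open Classical in
/-- The facets: all `(d-1)`-dimensional faces of elements, stored through their `d` vertices. -/
def SimplicialMesh.facets (T : SimplicialMesh d Ω) :
    Finset (Finset (EuclideanSpace ℝ (Fin d))) :=
  T.cells.biUnion fun K => K.powersetCard d

open Classical in
/-- The elements having `F` as a facet: two for an interior facet, one for a boundary facet. -/
def SimplicialMesh.adjacent (T : SimplicialMesh d Ω) (F : T.facets) : Finset T.cells :=
  Finset.univ.filter fun K => F.1 ⊆ K.1

/-- A choice, for each facet `F`, of the element called `K⁺`, together with the unit normal `n_F`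
of `F` that points out of `K⁺`. So `n_F` points from `K⁺` to `K⁻` on an interior facet, in an
arbitrary but fixed direction, and is the outer normal on a boundary facet. -/
structure FacetOrientation (T : SimplicialMesh d Ω) where
  /-- the element `K⁺` -/
  plus : T.facets → T.cells
  /-- the unit normal `n_F` -/
  normal : T.facets → EuclideanSpace ℝ (Fin d)
  plus_mem : ∀ F, plus F ∈ T.adjacent F
  norm_normal : ∀ F, ‖normal F‖ = 1
  normal_orthogonal : ∀ F, ∀ x ∈ F.1, ∀ y ∈ F.1, inner ℝ (x - y) (normal F) = 0
  normal_outward : ∀ F, ∀ x ∈ F.1, ∀ a ∈ (plus F).1, a ∉ F.1 → inner ℝ (a - x) (normal F) < 0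

/-- Polynomials in `d` variables of total degree at most `m`. -/
abbrev Poly (d m : ℕ) := MvPolynomial.restrictTotalDegree (Fin d) ℝ m

/-- The value of a polynomial at a point of `ℝ^d`. -/
def evalAt {m : ℕ} (p : Poly d m) (x : EuclideanSpace ℝ (Fin d)) : ℝ :=
  MvPolynomial.eval (fun i => x i) p.1

/-- The value at a point of the partial derivative `∂_j p`. -/
def partialAt {m : ℕ} (p : Poly d m) (j : Fin d) (x : EuclideanSpace ℝ (Fin d)) : ℝ :=
  MvPolynomial.eval (fun i => x i) (MvPolynomial.pderiv j p.1)

/-- The discontinuous velocity space `V_h`: on each element a vector field with components in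
`P_k`. A piecewise polynomial `L²` class is identified with its family of polynomials, one vector
of polynomials per element; the function itself is `velFun`. -/
abbrev VelSpace (T : SimplicialMesh d Ω) (k : ℕ) := T.cells → Fin d → Poly d k

/-- Discontinuous scalar piecewise polynomials of degree at most `m`. -/
abbrev ScalarSpace (T : SimplicialMesh d Ω) (m : ℕ) := T.cells → Poly d m

variable {T : SimplicialMesh d Ω} {k : ℕ}

/-- The polynomial vector field `v|_K`; on a facet of `K` it is the trace from within `K`. -/
def localVal (v : VelSpace T k) (K : T.cells) (x : EuclideanSpace ℝ (Fin d)) :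
    EuclideanSpace ℝ (Fin d) :=
  WithLp.toLp 2 fun i => evalAt (v K i) x

open Classical in
/-- The function `Ω → ℝ^d` given by `v ∈ V_h`; its value on the mesh skeleton (a null set) is
set to `0`. -/
def velFun (v : VelSpace T k) (x : EuclideanSpace ℝ (Fin d)) : EuclideanSpace ℝ (Fin d) :=
  ∑ K : T.cells, if x ∈ interior (hull K.1) then localVal v K x else 0

open Classical in
/-- The function `Ω → ℝ` given by a scalar piecewise polynomial. -/
def scalarFun {m : ℕ} (q : ScalarSpace T m) (x : EuclideanSpace ℝ (Fin d)) : ℝ :=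
  ∑ K : T.cells, if x ∈ interior (hull K.1) then evalAt (q K) x else 0

/-- The pressure space `Q_h`: piecewise `P_{k-1}` with zero mean. -/
def pressureSpace (T : SimplicialMesh d Ω) (k : ℕ) : Set (ScalarSpace T (k - 1)) :=
  {q | ∫ x in Ω, scalarFun q x = 0}

/-- The divergence of the polynomial field `v|_K`. -/
def localDiv (v : VelSpace T k) (K : T.cells) (x : EuclideanSpace ℝ (Fin d)) : ℝ :=
  ∑ i, partialAt (v K i) i x

/-- The facet diameter `h_F`. -/
def facetDiam (F : T.facets) : ℝ := Metric.diam (hull F.1)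

/-- `∮_F f ds`, with respect to the `(d-1)`-dimensional surface measure. -/
def facetIntegral (F : T.facets) (f : EuclideanSpace ℝ (Fin d) → ℝ) : ℝ :=
  ∫ x in hull F.1, f x ∂(Measure.euclideanHausdorffMeasure (d - 1))

/-- `∫_K f dx`. -/
def cellIntegral (K : T.cells) (f : EuclideanSpace ℝ (Fin d) → ℝ) : ℝ :=
  ∫ x in hull K.1, f x

open Classical in
/-- The jump: `v⁺ - v⁻` on an interior facet, and `v` on a boundary facet, where the sum over the
remaining adjacent elements is empty. -/
def jump (o : FacetOrientation T) (v : VelSpace T k) (F : T.facets)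
    (x : EuclideanSpace ℝ (Fin d)) : EuclideanSpace ℝ (Fin d) :=
  localVal v (o.plus F) x - ∑ K ∈ (T.adjacent F).erase (o.plus F), localVal v K x

/-- The average of the traces from the adjacent elements: `(φ⁺ + φ⁻) / 2` on an interior facet and
`φ` on a boundary facet. -/
def average (F : T.facets) (φ : T.cells → ℝ) : ℝ :=
  ((T.adjacent F).card : ℝ)⁻¹ * ∑ K ∈ T.adjacent F, φ K

/-- The normal jump `⟦v⟧ · n_F`. -/
def normalJump (o : FacetOrientation T) (v : VelSpace T k) (F : T.facets)
    (x : EuclideanSpace ℝ (Fin d)) : ℝ :=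
  inner ℝ (jump o v F x) (o.normal F)

/-- `{{∇ w}} n_F · ⟦v⟧`. -/
def avgGradNormalJump (o : FacetOrientation T) (w v : VelSpace T k) (F : T.facets)
    (x : EuclideanSpace ℝ (Fin d)) : ℝ :=
  ∑ i, ∑ j, average F (fun K => partialAt (w K i) j x) * o.normal F j * jump o v F x i

/-- `∫_Ω ∇_h w : ∇_h v dx`. -/
def gradForm (w v : VelSpace T k) : ℝ :=
  ∑ K : T.cells, cellIntegral K fun x => ∑ i, ∑ j, partialAt (w K i) j x * partialAt (v K i) j x

/-- The symmetric interior penalty form `a_h` with penalty parameter `σ`. -/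
def aForm (o : FacetOrientation T) (σ : ℝ) (w v : VelSpace T k) : ℝ :=
  gradForm w v
    + ∑ F : T.facets, σ / facetDiam F *
        facetIntegral F (fun x => inner ℝ (jump o w F x) (jump o v F x))
    - ∑ F : T.facets, facetIntegral F (avgGradNormalJump o w v F)
    - ∑ F : T.facets, facetIntegral F (avgGradNormalJump o v w F)

/-- The square of the discrete energy norm `‖·‖_e`. -/
def energySq (o : FacetOrientation T) (σ : ℝ) (v : VelSpace T k) : ℝ :=
  gradForm v v + ∑ F : T.facets, σ / facetDiam F * facetIntegral F (fun x => ‖jump o v F x‖ ^ 2)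

/-- Discrete coercivity of `a_h` on `V_h` with respect to the energy norm. -/
def IsCoercive (o : FacetOrientation T) (k : ℕ) (σ : ℝ) : Prop :=
  ∃ C > 0, ∀ v : VelSpace T k, C * energySq o σ v ≤ aForm o σ v v

/-- The discontinuous Galerkin pressure-velocity coupling `b_h`. -/
def bForm (o : FacetOrientation T) (w : VelSpace T k) (q : ScalarSpace T (k - 1)) : ℝ :=
  -(∑ K : T.cells, cellIntegral K fun x => evalAt (q K) x * localDiv w K x)
    + ∑ F : T.facets, facetIntegral F fun x =>
        average F (fun K => evalAt (q K) x) * normalJump o w F x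

/-- The discretely divergence-free velocities `V_h^div`. -/
def VDiv (o : FacetOrientation T) (k : ℕ) : Set (VelSpace T k) :=
  {v | ∀ q ∈ pressureSpace T k, bForm o v q = 0}

/-- `s ∈ L²(Ω)` is the weak (distributional) divergence of `w` in `Ω`. -/
def IsWeakDiv (Ω : Set (EuclideanSpace ℝ (Fin d)))
    (w : EuclideanSpace ℝ (Fin d) → EuclideanSpace ℝ (Fin d))
    (s : EuclideanSpace ℝ (Fin d) → ℝ) : Prop :=
  MemLp s 2 (volume.restrict Ω) ∧
    ∀ φ : EuclideanSpace ℝ (Fin d) → ℝ, ContDiff ℝ ∞ φ → HasCompactSupport φ → tsupport φ ⊆ Ω →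
      -∫ x in Ω, fderiv ℝ φ x (w x) = ∫ x in Ω, s x * φ x

/-- The space `H_0(div; Ω)`: square integrable fields `w` with a weak divergence `s ∈ L²(Ω)` and
vanishing normal trace. The normal trace is the functional `φ ↦ ∫_Ω (w · ∇φ + s φ) dx`, which equals
`∮_{∂Ω} (w · n) φ ds` for smooth `w`, on functions `φ` that are smooth up to the boundary. -/
def HZeroDiv (Ω : Set (EuclideanSpace ℝ (Fin d))) :
    Set (EuclideanSpace ℝ (Fin d) → EuclideanSpace ℝ (Fin d)) :=
  {w | MemLp w 2 (volume.restrict Ω) ∧ ∃ s, IsWeakDiv Ω w s ∧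
    ∀ φ : EuclideanSpace ℝ (Fin d) → ℝ, ContDiff ℝ ∞ φ → HasCompactSupport φ →
      (∫ x in Ω, fderiv ℝ φ x (w x)) + ∫ x in Ω, s x * φ x = 0}

/-- The Brezzi-Douglas-Marini space `W_h = V_h ∩ H_0(div; Ω)`. -/
def BDM (T : SimplicialMesh d Ω) (k : ℕ) : Set (VelSpace T k) :=
  {w | velFun w ∈ HZeroDiv Ω}

/-- `W_h^div = {w ∈ W_h : b(w, q) = 0 for all q ∈ Q_h}` with `b(w, q) = -∫_Ω q (∇ · w) dx`, where
`∇ · w` is the weak divergence. -/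
def WDiv (T : SimplicialMesh d Ω) (k : ℕ) : Set (VelSpace T k) :=
  {w | w ∈ BDM T k ∧ ∃ s, IsWeakDiv Ω (velFun w) s ∧
    ∀ q ∈ pressureSpace T k, -∫ x in Ω, scalarFun q x * s x = 0}

/-- `R_h^⊥`, the `a_h`-orthogonal complement of `W_h^div` in `V_h^div`. -/
def RPerp (o : FacetOrientation T) (k : ℕ) (σ : ℝ) : Set (VelSpace T k) :=
  {v | v ∈ VDiv o k ∧ ∀ w ∈ WDiv T k, aForm o σ v w = 0}

/-- The normal-jump seminorm `|·|_nj`. -/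
def njNorm (o : FacetOrientation T) (v : VelSpace T k) : ℝ :=
  Real.sqrt (∑ F : T.facets, 1 / facetDiam F * facetIntegral F (fun x => normalJump o v F x ^ 2))

end DGStokes

end

/-!
Everything rests on the divergence theorem on a simplex for the surface measure of the facets
(`integral_fderiv_simplex`). In the direction of an edge from `x₀` to `x₁` it is the fundamental
theorem of calculus on the segments parallel to that edge: only the facets opposite to `x₀` and to `x₁`
contribute, each with the factor `⟨x₁ - x₀, n⟩` that compares its area with the volume of the simplex
(base times height, `normDet_prismMap`). The edges at one vertex span all directions. Because the mesh
is conforming, two cells with a common facet lie on opposite sides of it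
(`inner_pos_of_convexHull_inter_subset`), so that summation over the cells leaves one jump per facet
(`sum_cellIntegral_fderiv`). This identity is used twice.

* Tested with smooth functions it says that the normal trace of a piecewise polynomial field `v`, taken
  with its elementwise divergence, is the sum of the normal jumps of `v` over all facets. Hence `v` lies
  in `H₀(div)` if and only if all its normal jumps vanish (`NormalContinuous.mem_BDM`,
  `normalContinuous_of_mem_HZeroDiv`).
* Applied to `x₁ vᵢ²` for a piecewise constant `v` without jumps it gives `∫ vᵢ² = 0`, so that the
  energy norm is definite (`eq_zero_of_energySq_eq_zero`).

Let `v ∈ R_h^⊥` have no normal jumps, either because its normal-jump seminorm is zero or because it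
lies in `H₀(div)`. The facet terms of `b_h(v, ·)` vanish, so `v ∈ W_h^div`, and `v` is `a_h`-orthogonal
to itself; coercivity gives `v = 0` (`eq_zero_of_normalContinuous`). Coercivity for large `σ` is
Young's inequality together with the discrete trace inequality, whose constant comes from the
equivalence of norms on a finite-dimensional space (`exists_isCoercive`).
-/

namespace DGStokes

/-! ### Volumes of affine images -/

section AffineImage

variable {U V : Type*} [NormedAddCommGroup U] [InnerProductSpace ℝ U]
  [NormedAddCommGroup V] [InnerProductSpace ℝ V]

theorem restrict_affine_image [FiniteDimensional ℝ U]
    [MeasurableSpace U] [BorelSpace U] [MeasurableSpace V] [BorelSpace V]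
    (f : U →ₗ[ℝ] V) (hf : Function.Injective f) (a : V) (S : Set U) :
    (Measure.euclideanHausdorffMeasure (Module.finrank ℝ U)).restrict ((fun u => a + f u) '' S) =
      ENNReal.ofReal f.normDet • (volume.restrict S).map (fun u => a + f u) := by
  have hm : Measurable (fun u => a + f u) :=
    (continuous_const.add f.continuous_of_finiteDimensional).measurable
  have hi : Function.Injective (fun u => a + f u) := fun x y h => hf (add_left_cancel h)
  ext s hs
  have h1 : s ∩ (fun u => a + f u) '' S = (fun v => a + v) '' (f '' ((fun u => a + f u) ⁻¹' s ∩ S)) := by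
    rw [← Set.image_preimage_inter, Set.image_image]
  rw [Measure.restrict_apply hs, Measure.smul_apply, Measure.map_apply hm hs,
    Measure.restrict_apply (hm hs), h1, (isometry_add_left a).euclideanHausdorffMeasure_image,
    LinearMap.euclideanHausdorffMeasure_image_eq_normDet_mul_volume, smul_eq_mul]

theorem setIntegral_affine_image [FiniteDimensional ℝ U]
    [MeasurableSpace U] [BorelSpace U] [MeasurableSpace V] [BorelSpace V]
    {m : ℕ}
    (hm : Module.finrank ℝ U = m) (f : U →ₗ[ℝ] V) (hf : Function.Injective f) (a : V) (S : Set U)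
    (g : V → ℝ) :
    ∫ x in (fun u => a + f u) '' S, g x ∂(Measure.euclideanHausdorffMeasure m) =
      f.normDet * ∫ u in S, g (a + f u) := by
  subst hm
  have he : Topology.IsClosedEmbedding (fun u => a + f u) :=
    (Homeomorph.addLeft a).isClosedEmbedding.comp
      (LinearMap.isClosedEmbedding_of_injective (LinearMap.ker_eq_bot.2 hf))
  rw [restrict_affine_image f hf, integral_smul_measure, he.measurableEmbedding.integral_map,
    ENNReal.toReal_ofReal f.normDet_nonneg, smul_eq_mul]

/-- The linear map `(t, s) ↦ A t + s • e`, on the Euclidean product `U × ℝ`. -/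
noncomputable def prismMap (A : U →ₗ[ℝ] V) (e : V) : WithLp 2 (U × ℝ) →ₗ[ℝ] V :=
  (A.coprod (LinearMap.toSpanSingleton ℝ V e)) ∘ₗ (WithLp.linearEquiv 2 ℝ (U × ℝ)).toLinearMap

theorem prismMap_apply (A : U →ₗ[ℝ] V) (e : V) (z : WithLp 2 (U × ℝ)) :
    prismMap A e z = A z.fst + z.snd • e := by
  simp [prismMap]

theorem continuous_prismMap [FiniteDimensional ℝ U] (A : U →ₗ[ℝ] V) (e : V) :
    Continuous (prismMap A e) := by
  have h : Continuous fun z : WithLp 2 (U × ℝ) => A z.fst + z.snd • e :=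
    (A.continuous_of_finiteDimensional.comp (WithLp.prod_continuous_ofLp 2 U ℝ).fst).add
      ((WithLp.prod_continuous_ofLp 2 U ℝ).snd.smul continuous_const)
  exact h.congr fun z => (prismMap_apply A e z).symm

theorem normDet_prismMap_unit [FiniteDimensional ℝ U] (A : U →ₗ[ℝ] V) (n : V) (hn : ‖n‖ = 1)
    (h : ∀ u, inner ℝ (A u) n = 0) : (prismMap A n).normDet = A.normDet := by
  have h' : ∀ u, inner ℝ n (A u) = 0 := fun u => by rw [real_inner_comm, h]
  let b := stdOrthonormalBasis ℝ U
  let w := OrthonormalBasis.singleton Unit ℝ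
  have h1 := (prismMap A n).normDet_sq_eq_det_gram (b.prod w)
  have h2 := A.normDet_sq_eq_det_gram b
  have h3 : Matrix.gram ℝ (fun x => prismMap A n ((b.prod w) x)) =
      Matrix.fromBlocks (Matrix.gram ℝ (fun x => A (b x))) 0 0 1 := by
    ext i j
    rcases i with i | i <;> rcases j with j | j <;>
      simp [Matrix.gram_apply, prismMap_apply, h, h', w, hn]
  rw [h3, Matrix.det_fromBlocks_zero₂₁, Matrix.det_one, mul_one, ← h2] at h1
  have h4 : (prismMap A n).normDet ^ 2 = A.normDet ^ 2 := by exact_mod_cast h1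
  exact (pow_left_inj₀ (LinearMap.normDet_nonneg _) (LinearMap.normDet_nonneg _) two_ne_zero).1 h4

/-- Base times height: the shear `x ↦ x + ⟨n, x⟩ (e - n)` has determinant `⟨n, e⟩` and maps the
right prism over `A` to the one in direction `e`. -/
theorem normDet_prismMap [FiniteDimensional ℝ U] (A : U →ₗ[ℝ] V) (n e : V) (hn : ‖n‖ = 1)
    (h : ∀ u, inner ℝ (A u) n = 0) [FiniteDimensional ℝ V]
    (hd : Module.finrank ℝ U + 1 = Module.finrank ℝ V) :
    (prismMap A e).normDet = |inner ℝ e n| * A.normDet := by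
  have h' : ∀ u, inner ℝ n (A u) = 0 := fun u => by rw [real_inner_comm, h]
  have h1 : prismMap A e = (LinearMap.transvection (innerₛₗ ℝ n) (e - n)) ∘ₗ prismMap A n := by
    ext z
    simp [prismMap_apply, LinearMap.transvection.apply, h', inner_add_right, inner_smul_right, hn]
    module
  rw [h1, LinearMap.normDet_comp_of_finrank_eq, normDet_prismMap_unit A n hn h,
    LinearMap.normDet_eq_abs_det, LinearMap.transvection.det]
  · congr 2
    simp [inner_sub_right, hn, real_inner_comm]
  · rw [← hd, (WithLp.linearEquiv 2 ℝ (U × ℝ)).finrank_eq]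
    simp

theorem normDet_prismMap_add [FiniteDimensional ℝ U] (A : U →ₗ[ℝ] V) (e : V) (l : Module.Dual ℝ U) :
    (prismMap (A + l.smulRight e) e).normDet = (prismMap A e).normDet := by
  let φ : Module.Dual ℝ (WithLp 2 (U × ℝ)) :=
    (l ∘ₗ LinearMap.fst ℝ U ℝ) ∘ₗ (WithLp.linearEquiv 2 ℝ (U × ℝ)).toLinearMap
  have h1 : prismMap (A + l.smulRight e) e =
      prismMap A e ∘ₗ LinearMap.transvection φ (WithLp.toLp 2 (0, 1)) := by
    ext z
    simp [prismMap_apply, LinearMap.transvection.apply, φ]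
    module
  rw [h1, LinearMap.normDet_comp_of_finrank_eq _ _ rfl, LinearMap.normDet_eq_abs_det,
    LinearMap.transvection.det]
  simp [φ]

end AffineImage

/-! ### The divergence theorem on a simplex -/

section Simplex

/-- The corner simplex `{t ≥ 0, ∑ tᵢ ≤ 1}`. -/
def cornerSimplex (ι : Type*) [Fintype ι] : Set (EuclideanSpace ℝ ι) :=
  {t | (∀ i, 0 ≤ t i) ∧ ∑ i, t i ≤ 1}

/-- The points `(t, s)` with `t` in the corner simplex and `0 ≤ s ≤ 1 - ∑ tᵢ`: a corner simplex with
one coordinate singled out. -/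
def splitSimplex (ι : Type*) [Fintype ι] : Set (WithLp 2 (EuclideanSpace ℝ ι × ℝ)) :=
  {z | (∀ i, 0 ≤ z.fst i) ∧ 0 ≤ z.snd ∧ z.snd ≤ 1 - ∑ i, z.fst i}

variable {ι : Type*} [Fintype ι]

theorem isCompact_splitSimplex : IsCompact (splitSimplex ι) := by
  have hc : IsCompact (Set.Icc (0 : ι → ℝ) 1 ×ˢ Set.Icc (0 : ℝ) 1) := isCompact_Icc.prod isCompact_Icc
  have hφ : Continuous (fun z : (ι → ℝ) × ℝ =>
    (WithLp.toLp 2 (WithLp.toLp 2 z.1, z.2) : WithLp 2 (EuclideanSpace ℝ ι × ℝ))) := by fun_prop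
  refine (hc.image hφ).of_isClosed_subset ?_ ?_
  · have h1 : IsClosed {z : WithLp 2 (EuclideanSpace ℝ ι × ℝ) | ∀ i, 0 ≤ z.fst i} := by
      simp only [Set.ofPred_forall]
      exact isClosed_iInter fun i => isClosed_le (by fun_prop) (by fun_prop)
    have h2 : IsClosed {z : WithLp 2 (EuclideanSpace ℝ ι × ℝ) | 0 ≤ z.snd} :=
      isClosed_le (by fun_prop) (by fun_prop)
    have h3 : IsClosed {z : WithLp 2 (EuclideanSpace ℝ ι × ℝ) | z.snd ≤ 1 - ∑ i, z.fst i} :=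
      isClosed_le (by fun_prop) (by fun_prop)
    exact h1.inter (h2.inter h3)
  · rintro z ⟨h0, hs, hs'⟩
    have hsum : ∀ i, z.fst i ≤ ∑ i, z.fst i := fun i =>
      Finset.single_le_sum (fun j _ => h0 j) (Finset.mem_univ i)
    have hn : 0 ≤ ∑ i, z.fst i := Finset.sum_nonneg fun i _ => h0 i
    refine ⟨(z.fst.ofLp, z.snd), ⟨⟨fun i => h0 i, fun i => ?_⟩, hs, ?_⟩, rfl⟩
    · have := hsum i
      simp only [Pi.one_apply]; linarith
    · show z.snd ≤ 1
      linarith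

theorem isCompact_cornerSimplex : IsCompact (cornerSimplex ι) := by
  have h : cornerSimplex ι = (fun z : WithLp 2 (EuclideanSpace ℝ ι × ℝ) => z.fst) ''
      splitSimplex ι := by
    ext t
    constructor
    · intro ht
      exact ⟨WithLp.toLp 2 (t, 0), ⟨ht.1, le_rfl, by simpa using ht.2⟩, rfl⟩
    · rintro ⟨z, hz, rfl⟩
      exact ⟨hz.1, by linarith [hz.2.1, hz.2.2]⟩
  rw [h]
  exact isCompact_splitSimplex.image (by fun_prop)

theorem measurableSet_cornerSimplex : MeasurableSet (cornerSimplex ι) :=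
  isCompact_cornerSimplex.measurableSet

theorem integral_splitSimplex {G : WithLp 2 (EuclideanSpace ℝ ι × ℝ) → ℝ} (hG : Continuous G) :
    ∫ z in splitSimplex ι, G z =
      ∫ t in cornerSimplex ι, ∫ s in (0 : ℝ)..(1 - ∑ i, t i), G (WithLp.toLp 2 (t, s)) := by
  have hm : MeasurableSet (splitSimplex ι) := isCompact_splitSimplex.measurableSet
  have hmp := WithLp.volume_preserving_toLp (EuclideanSpace ℝ ι) ℝ
  have hme : MeasurableEmbedding (WithLp.toLp 2 : EuclideanSpace ℝ ι × ℝ → _) :=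
    (MeasurableEquiv.toLp 2 (EuclideanSpace ℝ ι × ℝ)).measurableEmbedding
  have hint : Integrable ((splitSimplex ι).indicator G) :=
    (hG.continuousOn.integrableOn_compact isCompact_splitSimplex).integrable_indicator hm
  rw [← integral_indicator hm, ← hmp.integral_comp hme, Measure.volume_eq_prod, integral_prod,
    ← integral_indicator measurableSet_cornerSimplex]
  · congr 1
    ext t
    by_cases ht : t ∈ cornerSimplex ι
    · have ht' : (0 : ℝ) ≤ 1 - ∑ i, t i := by linarith [ht.2]
      rw [Set.indicator_of_mem ht, intervalIntegral.integral_of_le ht',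
        ← integral_Icc_eq_integral_Ioc, ← integral_indicator measurableSet_Icc]
      congr 1
      ext s
      by_cases hs : s ∈ Set.Icc (0 : ℝ) (1 - ∑ i, t i)
      · rw [Set.indicator_of_mem hs, Set.indicator_of_mem]
        exact ⟨ht.1, hs.1, hs.2⟩
      · rw [Set.indicator_of_notMem hs, Set.indicator_of_notMem]
        exact fun h => hs ⟨h.2.1, h.2.2⟩
    · rw [Set.indicator_of_notMem ht]
      refine integral_eq_zero_of_ae (Filter.Eventually.of_forall fun s => ?_)
      refine Set.indicator_of_notMem (fun h => ht ⟨h.1, ?_⟩) _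
      have h1 : 0 ≤ s := h.2.1
      have h2 : s ≤ 1 - ∑ i, t i := h.2.2
      linarith
  · rw [← Measure.volume_eq_prod]
    exact (hmp.integrable_comp_emb hme).2 hint

variable {V : Type*} [NormedAddCommGroup V] [InnerProductSpace ℝ V]

/-- `t ↦ ∑ᵢ tᵢ (pᵢ - y)`; shifted by `y` it maps the corner simplex onto the simplex with vertices
`y` and `pᵢ`. -/
noncomputable def edgeMap (p : ι → V) (y : V) : EuclideanSpace ℝ ι →ₗ[ℝ] V :=
  Fintype.linearCombination ℝ (fun i => p i - y) ∘ₗ (WithLp.linearEquiv 2 ℝ (ι → ℝ)).toLinearMap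

theorem edgeMap_apply (p : ι → V) (y : V) (t : EuclideanSpace ℝ ι) :
    edgeMap p y t = ∑ i, t i • (p i - y) := by
  simp [edgeMap, Fintype.linearCombination_apply]

theorem edgeMap_inner (p : ι → V) (y n : V) (h : ∀ i, inner ℝ (p i - y) n = 0)
    (t : EuclideanSpace ℝ ι) : inner ℝ (edgeMap p y t) n = 0 := by
  simp [edgeMap_apply, sum_inner, real_inner_smul_left, h]

theorem edgeMap_change (p : ι → V) (x₀ x₁ : V) (t : EuclideanSpace ℝ ι) :
    x₁ + edgeMap p x₁ t = x₀ + edgeMap p x₀ t + (1 - ∑ i, t i) • (x₁ - x₀) := by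
  have h : ∀ i, t i • (p i - x₁) = t i • (p i - x₀) - t i • (x₁ - x₀) := fun i => by module
  simp only [edgeMap_apply, h, Finset.sum_sub_distrib, ← Finset.sum_smul]
  module

variable [FiniteDimensional ℝ V] [MeasurableSpace V] [BorelSpace V]

/-- Integration of a derivative over a simplex in the direction of the edge from `x₀` to `x₁`: the
fundamental theorem of calculus on the segments parallel to that edge leaves the values on the two
facets opposite to `x₀` and to `x₁`. -/
theorem integral_fderiv_edge (p : ι → V) (x₀ x₁ n₀ n₁ : V)
    (hd : Fintype.card ι + 1 = Module.finrank ℝ V)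
    (hinj : Function.Injective (prismMap (edgeMap p x₀) (x₁ - x₀)))
    (hn₀ : ‖n₀‖ = 1) (hn₁ : ‖n₁‖ = 1) (ho₀ : ∀ i, inner ℝ (p i - x₁) n₀ = 0)
    (ho₁ : ∀ i, inner ℝ (p i - x₀) n₁ = 0) (hp₀ : 0 < inner ℝ (x₁ - x₀) n₀)
    (hp₁ : inner ℝ (x₁ - x₀) n₁ < 0) {f : V → ℝ} (hf : ContDiff ℝ 1 f) :
    ∫ x in (fun z => x₀ + prismMap (edgeMap p x₀) (x₁ - x₀) z) '' splitSimplex ι,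
        fderiv ℝ f x (x₁ - x₀) =
      inner ℝ (x₁ - x₀) n₀ * ∫ x in (fun t => x₁ + edgeMap p x₁ t) '' cornerSimplex ι,
          f x ∂(Measure.euclideanHausdorffMeasure (Fintype.card ι)) +
      inner ℝ (x₁ - x₀) n₁ * ∫ x in (fun t => x₀ + edgeMap p x₀ t) '' cornerSimplex ι,
          f x ∂(Measure.euclideanHausdorffMeasure (Fintype.card ι)) := by
  have hA : edgeMap p x₁ =
      edgeMap p x₀ + (-(Fintype.linearCombination ℝ (fun _ : ι => (1 : ℝ)) ∘ₗ
        (WithLp.linearEquiv 2 ℝ (ι → ℝ)).toLinearMap)).smulRight (x₁ - x₀) := by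
    ext1 t
    have := edgeMap_change p x₀ x₁ t
    rw [eq_comm, ← sub_eq_iff_eq_add'] at this
    rw [← this]
    simp [Fintype.linearCombination_apply]
    module
  have hU : Module.finrank ℝ (EuclideanSpace ℝ ι) = Fintype.card ι := finrank_euclideanSpace
  have hUV : Module.finrank ℝ (EuclideanSpace ℝ ι) + 1 = Module.finrank ℝ V := by rw [hU, hd]
  have hP : Module.finrank ℝ (WithLp 2 (EuclideanSpace ℝ ι × ℝ)) = Module.finrank ℝ V := by
    rw [(WithLp.linearEquiv 2 ℝ (EuclideanSpace ℝ ι × ℝ)).finrank_eq]; simpa using hd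
  have hD₁ := normDet_prismMap (edgeMap p x₀) n₁ (x₁ - x₀) hn₁ (edgeMap_inner p x₀ n₁ ho₁) hUV
  have hD₀ := normDet_prismMap (edgeMap p x₁) n₀ (x₁ - x₀) hn₀ (edgeMap_inner p x₁ n₀ ho₀) hUV
  have hD : (prismMap (edgeMap p x₁) (x₁ - x₀)).normDet =
      (prismMap (edgeMap p x₀) (x₁ - x₀)).normDet := by rw [hA, normDet_prismMap_add]
  have hpos : (prismMap (edgeMap p x₀) (x₁ - x₀)).normDet ≠ 0 :=
    ((LinearMap.normDet_ne_zero_tfae _).out 0 4).2 hinj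
  have hi₀ : Function.Injective (edgeMap p x₀) := by
    refine ((LinearMap.normDet_ne_zero_tfae _).out 0 4).1 fun h => hpos ?_
    rw [hD₁, h, mul_zero]
  have hi₁ : Function.Injective (edgeMap p x₁) := by
    refine ((LinearMap.normDet_ne_zero_tfae _).out 0 4).1 fun h => hpos ?_
    rw [← hD, hD₀, h, mul_zero]
  have hc : Continuous fun x => fderiv ℝ f x (x₁ - x₀) :=
    (hf.continuous_fderiv one_ne_zero).clm_apply continuous_const
  have hB : Continuous fun z => x₀ + prismMap (edgeMap p x₀) (x₁ - x₀) z :=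
    continuous_const.add (continuous_prismMap _ _)
  have hK := setIntegral_affine_image hP (prismMap (edgeMap p x₀) (x₁ - x₀)) hinj x₀
    (splitSimplex ι) (fun x => fderiv ℝ f x (x₁ - x₀))
  rw [InnerProductSpace.euclideanHausdorffMeasure_eq_volume] at hK
  have hftc : ∀ t : EuclideanSpace ℝ ι, (∫ s in (0 : ℝ)..(1 - ∑ i, t i),
      fderiv ℝ f (x₀ + prismMap (edgeMap p x₀) (x₁ - x₀) (WithLp.toLp 2 (t, s))) (x₁ - x₀)) =
      f (x₁ + edgeMap p x₁ t) - f (x₀ + edgeMap p x₀ t) := by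
    intro t
    have hder : ∀ s : ℝ, HasDerivAt (fun s : ℝ => f (x₀ + edgeMap p x₀ t + s • (x₁ - x₀)))
        (fderiv ℝ f (x₀ + prismMap (edgeMap p x₀) (x₁ - x₀) (WithLp.toLp 2 (t, s))) (x₁ - x₀)) s := by
      intro s
      have h1 : HasDerivAt (fun s : ℝ => x₀ + edgeMap p x₀ t + s • (x₁ - x₀)) (x₁ - x₀) s := by
        simpa using ((hasDerivAt_id s).smul_const (x₁ - x₀)).const_add (x₀ + edgeMap p x₀ t)
      have h2 := ((hf.differentiable one_ne_zero) (x₀ + edgeMap p x₀ t + s • (x₁ - x₀))).hasFDerivAt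
      have h3 := h2.comp_hasDerivAt s h1
      simpa [prismMap_apply, add_assoc, Function.comp_def] using h3
    rw [intervalIntegral.integral_eq_sub_of_hasDerivAt (fun s _ => hder s)]
    · rw [edgeMap_change p x₀ x₁]
      simp
    · exact ((hc.comp hB).comp (by fun_prop :
        Continuous fun s : ℝ => (WithLp.toLp 2 (t, s) : WithLp 2 _))).intervalIntegrable _ _
  have hcont : ∀ y, Continuous fun t => f (y + edgeMap p y t) := fun y =>
    hf.continuous.comp (continuous_const.add (LinearMap.continuous_of_finiteDimensional _))
  have hI : ∀ y, IntegrableOn (fun t => f (y + edgeMap p y t)) (cornerSimplex ι) := fun y =>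
    (hcont y).continuousOn.integrableOn_compact isCompact_cornerSimplex
  have hS := integral_splitSimplex (hc.comp hB)
  simp only [Function.comp_def] at hS
  rw [hK, hS, setIntegral_congr_fun measurableSet_cornerSimplex
    (fun t _ => hftc t), integral_sub (hI x₁) (hI x₀),
    setIntegral_affine_image hU _ hi₁, setIntegral_affine_image hU _ hi₀]
  rw [abs_of_pos hp₀] at hD₀
  rw [abs_of_neg hp₁] at hD₁
  rw [mul_sub, ← mul_assoc, ← mul_assoc, ← hD₀, hD, hD₁]
  ring

end Simplex

section SimplexGreen

variable {V : Type*} [NormedAddCommGroup V] [InnerProductSpace ℝ V]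

theorem convexHull_insert_eq_image [DecidableEq V] (G : Finset V) (y : V) (hy : y ∉ G) :
    convexHull ℝ ((insert y G : Finset V) : Set V) =
      (fun t => y + edgeMap (fun g : G => (g : V)) y t) '' cornerSimplex G := by
  ext x
  rw [Finset.mem_convexHull']
  constructor
  · rintro ⟨w, h0, h1, h2⟩
    rw [Finset.sum_insert hy, ← Finset.sum_coe_sort] at h1 h2
    refine ⟨WithLp.toLp 2 fun g => w g, ⟨fun g => h0 g (Finset.mem_insert_of_mem g.2), ?_⟩, ?_⟩
    · have := h0 y (Finset.mem_insert_self y G)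
      change ∑ g : G, w g ≤ 1
      linarith
    · simp only [edgeMap_apply, smul_sub, Finset.sum_sub_distrib, ← Finset.sum_smul]
      rw [← eq_sub_iff_add_eq] at h1
      rw [← h2, h1]
      module
  · rintro ⟨t, ⟨h0, h1⟩, rfl⟩
    rw [← Finset.mem_convexHull']
    have h := (convex_convexHull ℝ ((insert y G : Finset V) : Set V)).sum_mem
      (t := Finset.univ) (w := fun o : Option G => o.elim (1 - ∑ i, t i) t)
      (z := fun o : Option G => o.elim y (fun g => (g : V))) ?_ ?_ ?_
    · convert h using 1
      simp only [Fintype.sum_option, Option.elim, edgeMap_apply, smul_sub, Finset.sum_sub_distrib,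
        ← Finset.sum_smul]
      module
    · rintro (_ | g) -
      · simpa using h1
      · exact h0 g
    · simp [Fintype.sum_option]
    · rintro (_ | g) - <;> apply subset_convexHull <;> simp

theorem convexHull_insert_insert_eq_image [DecidableEq V] (G : Finset V) (x₀ x₁ : V)
    (h₀ : x₀ ∉ insert x₁ G) (h₁ : x₁ ∉ G) :
    convexHull ℝ ((insert x₀ (insert x₁ G) : Finset V) : Set V) =
      (fun z => x₀ + prismMap (edgeMap (fun g : G => (g : V)) x₀) (x₁ - x₀) z) ''
        splitSimplex G := by
  ext x
  rw [Finset.mem_convexHull']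
  constructor
  · rintro ⟨w, h0, h1, h2⟩
    rw [Finset.sum_insert h₀, Finset.sum_insert h₁, ← Finset.sum_coe_sort] at h1 h2
    refine ⟨WithLp.toLp 2 (WithLp.toLp 2 fun g => w g, w x₁),
      ⟨fun g => h0 g (by simp), h0 x₁ (by simp), ?_⟩, ?_⟩
    · have := h0 x₀ (by simp)
      change w x₁ ≤ 1 - ∑ g : G, w g
      linarith
    · simp only [prismMap_apply, edgeMap_apply, smul_sub, Finset.sum_sub_distrib, ← Finset.sum_smul]
      rw [← eq_sub_iff_add_eq] at h1
      rw [← h2, h1]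
      change x₀ + (∑ g : G, w g • (g : V) - (∑ g : G, w g) • x₀ + (w x₁ • x₁ - w x₁ • x₀)) = _
      module
  · rintro ⟨z, ⟨h0, h1, h2⟩, rfl⟩
    rw [← Finset.mem_convexHull']
    have h := (convex_convexHull ℝ ((insert x₀ (insert x₁ G) : Finset V) : Set V)).sum_mem
      (t := Finset.univ)
      (w := fun o : Option (Option G) =>
        o.elim (1 - ∑ i, z.fst i - z.snd) (fun o => o.elim z.snd z.fst))
      (z := fun o : Option (Option G) => o.elim x₀ (fun o => o.elim x₁ (fun g => (g : V)))) ?_ ?_ ?_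
    · convert h using 1
      simp only [Fintype.sum_option, Option.elim, prismMap_apply, edgeMap_apply, smul_sub,
        Finset.sum_sub_distrib, ← Finset.sum_smul]
      module
    · rintro (_ | _ | g) -
      · simp only [Option.elim]; linarith
      · exact h1
      · exact h0 g
    · simp only [Fintype.sum_option, Option.elim]
      ring
    · rintro (_ | _ | g) - <;> apply subset_convexHull <;> simp

theorem injective_prismMap_edgeMap [DecidableEq V] (G : Finset V) (x₀ x₁ : V)
    (h₀ : x₀ ∉ insert x₁ G) (h₁ : x₁ ∉ G)
    (hi : AffineIndependent ℝ ((↑) : (insert x₀ (insert x₁ G) : Finset V) → V)) :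
    Function.Injective (prismMap (edgeMap (fun g : G => (g : V)) x₀) (x₁ - x₀)) := by
  rw [← LinearMap.ker_eq_bot, LinearMap.ker_eq_bot']
  intro z hz
  simp only [prismMap_apply, edgeMap_apply, smul_sub, Finset.sum_sub_distrib,
    ← Finset.sum_smul] at hz
  let w : V → ℝ := fun v => if v = x₀ then -(∑ i, z.fst i + z.snd) else if v = x₁ then z.snd else
    if h : v ∈ G then z.fst ⟨v, h⟩ else 0
  have hx : x₁ ≠ x₀ := fun h => h₀ (by simp [h])
  have hw0 : w x₀ = -(∑ i, z.fst i + z.snd) := by simp [w]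
  have hw1 : w x₁ = z.snd := by simp [w, hx]
  have hwG : ∀ g : G, w g = z.fst g := by
    intro g
    have a0 : (g : V) ≠ x₀ := fun h => h₀ (by simp [← h])
    have a1 : (g : V) ≠ x₁ := fun h => h₁ (by simp [← h])
    simp [w, a0, a1]
  have key := hi.eq_zero_of_sum_eq_zero_subtype (w := w) ?_ ?_
  · have hs : z.snd = 0 := by rw [← hw1]; exact key x₁ (by simp)
    have hf : z.fst = 0 := by
      ext g
      rw [← hwG]; exact key g (by simp)
    exact WithLp.ofLp_injective 2 (Prod.ext hf hs)
  · rw [Finset.sum_insert h₀, Finset.sum_insert h₁, ← Finset.sum_coe_sort]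
    simp only [hw0, hw1, hwG]
    ring
  · rw [Finset.sum_insert h₀, Finset.sum_insert h₁, ← Finset.sum_coe_sort]
    simp only [hw0, hw1, hwG]
    rw [← hz]
    module

variable [MeasurableSpace V] [BorelSpace V]

/-- A simplex with `m + 1` vertices has finite `m`-dimensional measure. -/
theorem euclideanHausdorffMeasure_convexHull_lt_top (F : Finset V) {m : ℕ} (hF : F.card = m + 1) :
    Measure.euclideanHausdorffMeasure m (convexHull ℝ (F : Set V)) < ⊤ := by
  classical
  obtain ⟨y, hy⟩ : F.Nonempty := Finset.card_pos.1 (by omega)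
  have hc : Module.finrank ℝ (EuclideanSpace ℝ ↥(F.erase y)) = m := by
    simp [Finset.card_erase_of_mem hy, hF]
  rw [← Finset.insert_erase hy, convexHull_insert_eq_image _ _ (Finset.notMem_erase y F)]
  rw [← Set.image_image (fun v => y + v),
    (isometry_add_left y).euclideanHausdorffMeasure_image, ← hc,
    LinearMap.euclideanHausdorffMeasure_image_eq_normDet_mul_volume]
  exact ENNReal.mul_lt_top ENNReal.ofReal_lt_top isCompact_cornerSimplex.measure_lt_top

theorem euclideanHausdorffMeasure_convexHull_eq_zero (F : Finset V) {m : ℕ} (hF : F.card ≤ m) :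
    Measure.euclideanHausdorffMeasure m (convexHull ℝ (F : Set V)) = 0 := by
  rcases F.eq_empty_or_nonempty with rfl | hne
  · simp
  · have h := euclideanHausdorffMeasure_convexHull_lt_top F (m := F.card - 1)
      (by have := hne.card_pos; omega)
    exact (Measure.euclideanHausdorffMeasure_zero_or_top
      (by have := hne.card_pos; omega) _).resolve_right h.ne

variable [FiniteDimensional ℝ V]

/-- The divergence theorem on a simplex `K`, in a fixed direction `e`; `ν a` is the unit outer normal
on the facet opposite to the vertex `a`. For an edge `e` only two facets contribute, and the edges at
one vertex span. -/
theorem integral_fderiv_simplex [DecidableEq V] (K : Finset V)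
    (hK : AffineIndependent ℝ ((↑) : K → V)) (hc : K.card = Module.finrank ℝ V + 1) (ν : V → V)
    (h1 : ∀ a ∈ K, ‖ν a‖ = 1)
    (h2 : ∀ a ∈ K, ∀ x ∈ K.erase a, ∀ y ∈ K.erase a, inner ℝ (x - y) (ν a) = 0)
    (h3 : ∀ a ∈ K, ∀ x ∈ K.erase a, inner ℝ (a - x) (ν a) < 0)
    {f : V → ℝ} (hf : ContDiff ℝ 1 f) (e : V) :
    ∫ x in convexHull ℝ (K : Set V), fderiv ℝ f x e =
      ∑ a ∈ K, inner ℝ e (ν a) * ∫ x in convexHull ℝ ((K.erase a : Finset V) : Set V),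
        f x ∂(Measure.euclideanHausdorffMeasure (Module.finrank ℝ V - 1)) := by
  obtain ⟨x₀, hx₀⟩ : K.Nonempty := Finset.card_pos.1 (by omega)
  have hcomp : IsCompact (convexHull ℝ (K : Set V)) := K.finite_toSet.isCompact_convexHull ℝ
  have hint : ∀ e, IntegrableOn (fun x => fderiv ℝ f x e) (convexHull ℝ (K : Set V)) := fun e =>
    ((hf.continuous_fderiv one_ne_zero).clm_apply
      continuous_const).continuousOn.integrableOn_compact hcomp
  have hspan : Submodule.span ℝ ((fun x => x -ᵥ x₀) '' (K : Set V)) = ⊤ := by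
    rw [← vectorSpan_eq_span_vsub_set_right ℝ (Finset.mem_coe.2 hx₀)]
    have := (hK.affineSpan_eq_top_iff_card_eq_finrank_add_one).2 (by simpa using hc)
    rw [Subtype.range_coe_subtype] at this
    have h4 := AffineSubspace.vectorSpan_eq_top_of_affineSpan_eq_top ℝ V V this
    simpa using h4
  have he : e ∈ Submodule.span ℝ ((fun x => x -ᵥ x₀) '' (K : Set V)) := by rw [hspan]; trivial
  induction he using Submodule.span_induction with
  | zero => simp
  | add u v _ _ hu hv =>
    simp only [map_add, inner_add_left, add_mul, Finset.sum_add_distrib]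
    rw [integral_add (hint u) (hint v), hu, hv]
  | smul c u _ hu =>
    simp only [map_smul, smul_eq_mul, real_inner_smul_left, mul_assoc]
    rw [integral_const_mul, hu, Finset.mul_sum]
  | mem u hu =>
    obtain ⟨x₁, hx₁, rfl⟩ := hu
    replace hx₁ : x₁ ∈ K := hx₁
    simp only [vsub_eq_sub]
    rcases eq_or_ne x₁ x₀ with rfl | hne
    · simp
    have hG : ∀ {a b : V}, a ∈ K → b ∈ K → a ≠ b → insert a ((K.erase b).erase a) = K.erase b :=
      fun ha _ hab => Finset.insert_erase (Finset.mem_erase.2 ⟨hab, ha⟩)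
    set G := (K.erase x₀).erase x₁ with hGd
    have e0 : insert x₁ G = K.erase x₀ := hG hx₁ hx₀ hne
    have e1 : insert x₀ G = K.erase x₁ := by
      rw [hGd, Finset.erase_right_comm]; exact hG hx₀ hx₁ hne.symm
    have eK : insert x₀ (insert x₁ G) = K := by rw [e0, Finset.insert_erase hx₀]
    have n1 : x₁ ∉ G := Finset.notMem_erase _ _
    have n0' : x₀ ∉ insert x₁ G := by rw [e0]; exact Finset.notMem_erase _ _
    have n0 : x₀ ∉ G := fun h => n0' (Finset.mem_insert_of_mem h)
    have cG : Fintype.card G + 1 = Module.finrank ℝ V := by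
      have a := Finset.card_insert_of_notMem n0'
      rw [Finset.card_insert_of_notMem n1, eK] at a
      rw [Fintype.card_coe]; omega
    have hinj := injective_prismMap_edgeMap G x₀ x₁ n0' n1 (by rw [eK]; exact hK)
    have mG0 : ∀ g : G, (g : V) ∈ K.erase x₀ := fun g => by
      rw [← e0]; exact Finset.mem_insert_of_mem g.2
    have mG1 : ∀ g : G, (g : V) ∈ K.erase x₁ := fun g => by
      rw [← e1]; exact Finset.mem_insert_of_mem g.2
    have m10 : x₁ ∈ K.erase x₀ := Finset.mem_erase.2 ⟨hne, hx₁⟩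
    have m01 : x₀ ∈ K.erase x₁ := Finset.mem_erase.2 ⟨hne.symm, hx₀⟩
    have key := integral_fderiv_edge (fun g : G => (g : V)) x₀ x₁ (ν x₀) (ν x₁) cG hinj
      (h1 x₀ hx₀) (h1 x₁ hx₁) (fun g => h2 x₀ hx₀ _ (mG0 g) _ m10)
      (fun g => h2 x₁ hx₁ _ (mG1 g) _ m01)
      (by have := h3 x₀ hx₀ x₁ m10
          rw [← neg_sub, inner_neg_left] at this
          linarith) (h3 x₁ hx₁ x₀ m01) hf
    rw [← convexHull_insert_insert_eq_image G x₀ x₁ n0' n1, ← convexHull_insert_eq_image G x₁ n1,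
      ← convexHull_insert_eq_image G x₀ n0, eK, e0, e1] at key
    have hm : Fintype.card G = Module.finrank ℝ V - 1 := by omega
    rw [key, hm, Finset.sum_eq_add x₀ x₁ hne.symm]
    · rintro b hb ⟨hb0, hb1⟩
      rw [h2 b hb x₁ (Finset.mem_erase.2 ⟨hb1.symm, hx₁⟩) x₀ (Finset.mem_erase.2 ⟨hb0.symm, hx₀⟩),
        zero_mul]
    · exact fun h => absurd hx₀ h
    · exact fun h => absurd hx₁ h

end SimplexGreen

/-! ### Facets of a conforming mesh -/

section TwoSimplices

variable {V : Type*} [NormedAddCommGroup V] [InnerProductSpace ℝ V] [FiniteDimensional ℝ V]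

/-- Two full-dimensional simplices that share the facet `F` and meet only in `F` lie on opposite sides
of it: if `b` were on the side of `a`, a point of the segment from the barycentre of `F` to `b` that is
close to `F` would lie in both simplices. -/
theorem inner_pos_of_convexHull_inter_subset [DecidableEq V] (F : Finset V) (a b : V) (ha : a ∉ F)
    (hb : b ∉ F) (hK : AffineIndependent ℝ ((↑) : ↥(insert a F) → V))
    (hc : (insert a F).card = Module.finrank ℝ V + 1)
    (hL : AffineIndependent ℝ ((↑) : ↥(insert b F) → V))
    (hKL : convexHull ℝ ((insert a F : Finset V) : Set V) ∩
      convexHull ℝ ((insert b F : Finset V) : Set V) ⊆ convexHull ℝ (F : Set V))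
    (n x : V) (hx : x ∈ F) (hn : ∀ y ∈ F, inner ℝ (y - x) n = 0) (han : inner ℝ (a - x) n < 0) :
    0 < inner ℝ (b - x) n := by
  obtain ⟨w, hw1, hwb⟩ : ∃ w : V → ℝ, ∑ v ∈ insert a F, w v = 1 ∧ ∑ v ∈ insert a F, w v • v = b := by
    have htop := (hK.affineSpan_eq_top_iff_card_eq_finrank_add_one).2 (by simpa using hc)
    let B : AffineBasis ↥(insert a F) ℝ V := ⟨_, hK, htop⟩
    refine ⟨fun v => if h : v ∈ insert a F then B.coord ⟨v, h⟩ b else 0, ?_, ?_⟩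
    · rw [← Finset.sum_coe_sort, ← B.sum_coord_apply_eq_one b]
      exact Finset.sum_congr rfl fun i _ => by simp [-Finset.mem_insert]
    · rw [← Finset.sum_coe_sort]
      conv_rhs => rw [← B.linear_combination_coord_eq_self b]
      exact Finset.sum_congr rfl fun i _ => by simp only [dif_pos i.2]; rfl
  rw [Finset.sum_insert ha] at hw1 hwb
  have hF0 : 0 < (F.card : ℝ) := by exact_mod_cast Finset.card_pos.2 ⟨x, hx⟩
  have hbx : inner ℝ (b - x) n = w a * inner ℝ (a - x) n := by
    have h1 : b - x = w a • (a - x) + ∑ v ∈ F, w v • (v - x) := by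
      simp only [smul_sub, Finset.sum_sub_distrib, ← Finset.sum_smul]
      rw [← eq_sub_iff_add_eq] at hw1
      rw [← hwb, hw1]
      module
    rw [h1, inner_add_left, sum_inner, real_inner_smul_left, Finset.sum_eq_zero, add_zero]
    intro v hv
    rw [real_inner_smul_left, hn v hv, mul_zero]
  by_contra hneg
  have hwa : 0 ≤ w a := by
    rw [hbx] at hneg
    by_contra h
    exact hneg (mul_pos_of_neg_of_neg (not_le.1 h) han)
  set M := ∑ v ∈ F, |w v| with hM
  have hM0 : 0 ≤ M := Finset.sum_nonneg fun v _ => abs_nonneg _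
  -- small enough for the barycentric coordinates on `F` to stay nonnegative
  set t : ℝ := (1 + F.card * M)⁻¹ with ht
  have hden : 0 < 1 + F.card * M := by positivity
  have ht0 : 0 < t := inv_pos.2 hden
  have ht1 : t ≤ 1 := inv_le_one_of_one_le₀ (by nlinarith)
  have htM : (1 - t) / F.card = t * M := by
    rw [ht]; field_simp; ring
  set y : V := ∑ v ∈ F, (F.card : ℝ)⁻¹ • v with hy
  have hyF : y ∈ convexHull ℝ (F : Set V) := by
    refine Finset.mem_convexHull'.2 ⟨fun _ => (F.card : ℝ)⁻¹, fun _ _ => by positivity, ?_, rfl⟩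
    rw [Finset.sum_const, nsmul_eq_mul, mul_inv_cancel₀ hF0.ne']
  have hz : (1 - t) • y + t • b ∈ convexHull ℝ (F : Set V) := by
    refine hKL ⟨Finset.mem_convexHull'.2
      ⟨fun v => if v = a then t * w a else (1 - t) / F.card + t * w v, ?_, ?_, ?_⟩, ?_⟩
    · intro v hv
      rcases eq_or_ne v a with rfl | hva
      · simpa using by positivity
      · have hvF : v ∈ F := (Finset.mem_insert.1 hv).resolve_left hva
        have h1 : |w v| ≤ M := Finset.single_le_sum (f := fun v => |w v|)
          (fun v _ => abs_nonneg _) hvF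
        have h2 := neg_abs_le (w v)
        simp only [hva, if_false, htM]
        nlinarith
    · rw [Finset.sum_insert ha, if_pos rfl, Finset.sum_congr rfl fun v hv =>
        if_neg (fun h : v = a => ha (h ▸ hv)), Finset.sum_add_distrib, Finset.sum_const,
        ← Finset.mul_sum, nsmul_eq_mul, mul_div_cancel₀ _ hF0.ne']
      linear_combination t * hw1
    · simp only []
      rw [Finset.sum_insert ha, if_pos rfl, Finset.sum_congr rfl fun v hv =>
        congrArg (· • v) (if_neg (fun h : v = a => ha (h ▸ hv)))]
      simp only [add_smul, Finset.sum_add_distrib, mul_smul, ← Finset.smul_sum]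
      have hy' : y = (F.card : ℝ)⁻¹ • ∑ v ∈ F, v := by rw [hy, Finset.smul_sum]
      clear_value y t
      rw [hy', ← hwb, div_eq_mul_inv, ← Finset.smul_sum]
      module
    · exact (convex_convexHull ℝ _) (convexHull_mono (by simp) hyF)
        (subset_convexHull ℝ _ (by simp)) (by linarith) ht0.le (by ring)
  -- so `b` lies in the affine span of `F`
  have hbF : b ∈ affineSpan ℝ (F : Set V) := by
    have h1 := convexHull_subset_affineSpan (𝕜 := ℝ) (F : Set V) hz
    have h2 := convexHull_subset_affineSpan (𝕜 := ℝ) (F : Set V) hyF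
    have h3 := AffineMap.lineMap_mem t⁻¹ h2 h1
    convert h3 using 1
    rw [AffineMap.lineMap_apply_module]
    simp only [smul_add, smul_smul, mul_sub, inv_mul_cancel₀ ht0.ne', mul_one]
    module
  -- but `b` and `F` are affinely independent
  have h4 := hL.notMem_affineSpan_sdiff ⟨b, Finset.mem_insert_self b F⟩ Set.univ
  refine h4 ?_
  convert hbF using 2
  ext v
  simp only [Set.mem_image, Set.mem_sdiff, Set.mem_univ, Set.mem_singleton_iff, true_and]
  constructor
  · rintro ⟨u, hu, rfl⟩
    rcases Finset.mem_insert.1 u.2 with h | h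
    · exact absurd (Subtype.ext h) hu
    · exact h
  · intro hv
    exact ⟨⟨v, Finset.mem_insert_of_mem hv⟩, fun h => hb (by cases h; exact hv), rfl⟩

end TwoSimplices

variable {d : ℕ} {Ω : Set (EuclideanSpace ℝ (Fin d))} {T : SimplicialMesh d Ω} {k : ℕ}

theorem card_facet (F : T.facets) : F.1.card = d := by
  obtain ⟨K, -, hF⟩ := Finset.mem_biUnion.1 F.2
  exact (Finset.mem_powersetCard.1 hF).2

theorem mem_adjacent {F : T.facets} {K : T.cells} : K ∈ T.adjacent F ↔ F.1 ⊆ K.1 := by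
  simp [SimplicialMesh.adjacent]

theorem subset_mem_facets {K S : Finset (EuclideanSpace ℝ (Fin d))} (hK : K ∈ T.cells) (hS : S ⊆ K)
    (hc : S.card = d) : S ∈ T.facets :=
  Finset.mem_biUnion.2 ⟨K, hK, Finset.mem_powersetCard.2 ⟨hS, hc⟩⟩

open Classical in
theorem exists_insert_facet {F : T.facets} {K : T.cells} (h : K ∈ T.adjacent F) :
    ∃ a, a ∉ F.1 ∧ insert a F.1 = K.1 := by
  have := (Finset.exists_eq_insert_iff (s := F.1) (t := K.1)).2
    ⟨mem_adjacent.1 h, by rw [card_facet, T.card_eq K.1 K.2]⟩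
  simpa using this

/-- Two cells with a common facet lie on opposite sides of it. -/
theorem inner_pos_of_adjacent {F : T.facets} {K L : T.cells} (hK : K ∈ T.adjacent F)
    (hL : L ∈ T.adjacent F) (hKL : K ≠ L) {n : EuclideanSpace ℝ (Fin d)}
    (hn : ∀ x ∈ F.1, ∀ y ∈ F.1, inner ℝ (x - y) n = 0)
    (hneg : ∀ x ∈ F.1, ∀ a ∈ K.1, a ∉ F.1 → inner ℝ (a - x) n < 0) :
    ∀ x ∈ F.1, ∀ b ∈ L.1, b ∉ F.1 → 0 < inner ℝ (b - x) n := by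
  classical
  intro x hx b hb hbF
  obtain ⟨a, ha, haK⟩ := exists_insert_facet hK
  obtain ⟨b', hb', hbL⟩ := exists_insert_facet hL
  have hbb : b = b' := by
    rw [← hbL] at hb
    exact (Finset.mem_insert.1 hb).resolve_right hbF
  subst hbb
  have hab : a ≠ b := by
    rintro rfl
    exact hKL (Subtype.ext (haK.symm.trans hbL))
  refine inner_pos_of_convexHull_inter_subset F.1 a b ha hb' ?_ ?_ ?_ ?_ n x hx
    (fun y hy => hn y hy x hx) (hneg x hx a (by rw [← haK]; simp) ha)
  · rw [haK]; exact T.indep K.1 K.2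
  · rw [haK, T.card_eq K.1 K.2, finrank_euclideanSpace_fin]
  · rw [hbL]; exact T.indep L.1 L.2
  · rw [haK, hbL, T.conforming K.1 K.2 L.1 L.2, ← haK, ← hbL]
    refine convexHull_mono ?_
    rintro v ⟨h1, h2⟩
    simp only [Finset.coe_insert, Set.mem_insert_iff, Finset.mem_coe] at h1 h2 ⊢
    rcases h1 with rfl | h1
    · rcases h2 with h2 | h2
      · exact absurd h2 hab
      · exact h2
    · exact h1

open Classical in
/-- A facet has at most one adjacent cell besides `K⁺`. -/
theorem card_adjacent_erase_le_one (hd : 1 ≤ d) (o : FacetOrientation T) (F : T.facets) :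
    ((T.adjacent F).erase (o.plus F)).card ≤ 1 := by
  rw [Finset.card_le_one]
  intro K hK L hL
  by_contra hne
  obtain ⟨hK1, hK2⟩ := Finset.mem_erase.1 hK
  obtain ⟨hL1, hL2⟩ := Finset.mem_erase.1 hL
  have h1 := inner_pos_of_adjacent (o.plus_mem F) hK2 (Ne.symm hK1) (o.normal_orthogonal F)
    (o.normal_outward F)
  have h2 := inner_pos_of_adjacent (o.plus_mem F) hL2 (Ne.symm hL1) (o.normal_orthogonal F)
    (o.normal_outward F)
  have h3 := inner_pos_of_adjacent hK2 hL2 hne (n := -o.normal F)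
    (fun x hx y hy => by rw [inner_neg_right, o.normal_orthogonal F x hx y hy, neg_zero])
    (fun x hx a ha haF => by
      rw [inner_neg_right]; linarith [h1 x hx a ha haF])
  obtain ⟨x, hx⟩ : F.1.Nonempty := Finset.card_pos.1 (by rw [card_facet]; omega)
  obtain ⟨b, hb, hbL⟩ := exists_insert_facet hL2
  have hbL' : b ∈ L.1 := by rw [← hbL]; simp
  have := h3 x hx b hbL' hb
  rw [inner_neg_right] at this
  linarith [h2 x hx b hbL' hb]

open Classical in
/-- The sign for which `facetSign o K F • n_F` points out of `K`. -/
noncomputable def facetSign (o : FacetOrientation T) (K : T.cells) (F : T.facets) : ℝ :=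
  if K = o.plus F then 1 else -1

theorem facetSign_outward (o : FacetOrientation T) {K : T.cells} {F : T.facets}
    (hK : K ∈ T.adjacent F) : ∀ x ∈ F.1, ∀ a ∈ K.1, a ∉ F.1 →
      inner ℝ (a - x) (facetSign o K F • o.normal F) < 0 := by
  intro x hx a ha haF
  rw [facetSign]
  split_ifs with h
  · subst h
    simpa using o.normal_outward F x hx a ha haF
  · have := inner_pos_of_adjacent (o.plus_mem F) hK (Ne.symm h) (o.normal_orthogonal F)
      (o.normal_outward F) x hx a ha haF
    simpa [inner_neg_right] using this

theorem norm_facetSign_smul (o : FacetOrientation T) (K : T.cells) (F : T.facets) :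
    ‖facetSign o K F • o.normal F‖ = 1 := by
  rw [norm_smul, o.norm_normal, facetSign]
  split_ifs <;> simp

open Classical in
/-- A sum over all pairs of a cell and one of its facets, arranged by cells or by facets. -/
theorem sum_cells_sum_erase (g : T.cells → Finset (EuclideanSpace ℝ (Fin d)) → ℝ) :
    ∑ K : T.cells, ∑ a ∈ K.1, g K (K.1.erase a) = ∑ F : T.facets, ∑ K ∈ T.adjacent F, g K F.1 := by
  simp only [SimplicialMesh.adjacent, Finset.sum_filter]
  rw [Finset.sum_comm]
  refine Finset.sum_congr rfl fun K _ => ?_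
  rw [← Finset.sum_filter]
  have hc : ∀ a ∈ K.1, (K.1.erase a).card = d := fun a ha => by
    rw [Finset.card_erase_of_mem ha, T.card_eq K.1 K.2]; rfl
  refine Finset.sum_bij
    (fun a ha => ⟨K.1.erase a, subset_mem_facets K.2 (Finset.erase_subset _ _) (hc a ha)⟩) ?_ ?_ ?_ ?_
  · intro a ha
    simp [Finset.erase_subset]
  · intro a ha b hb hab
    exact Finset.erase_injOn _ ha hb (congrArg Subtype.val hab)
  · intro F hF
    obtain ⟨a, ha, haK⟩ := exists_insert_facet (mem_adjacent.2 (Finset.mem_filter.1 hF).2)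
    refine ⟨a, by rw [← haK]; simp, Subtype.ext ?_⟩
    simp [← haK, ha]
  · intro a ha
    rfl

theorem isCompact_hull (S : Finset (EuclideanSpace ℝ (Fin d))) : IsCompact (hull S) :=
  S.finite_toSet.isCompact_convexHull ℝ

theorem measure_facet_lt_top (hd : 1 ≤ d) (F : T.facets) :
    Measure.euclideanHausdorffMeasure (d - 1) (hull F.1) < ⊤ :=
  euclideanHausdorffMeasure_convexHull_lt_top F.1 (by rw [card_facet]; omega)

theorem integrableOn_facet (hd : 1 ≤ d) (F : T.facets) {g : EuclideanSpace ℝ (Fin d) → ℝ}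
    (hg : Continuous g) : IntegrableOn g (hull F.1) (Measure.euclideanHausdorffMeasure (d - 1)) := by
  obtain ⟨C, hC⟩ := (isCompact_hull F.1).exists_bound_of_continuousOn hg.continuousOn
  exact Measure.integrableOn_of_bounded (measure_facet_lt_top hd F).ne hg.aestronglyMeasurable
    (M := C) ((ae_restrict_iff' (isCompact_hull F.1).measurableSet).2 (Filter.Eventually.of_forall hC))

theorem integrableOn_cell (K : T.cells) {g : EuclideanSpace ℝ (Fin d) → ℝ}
    (hg : Continuous g) : IntegrableOn g (hull K.1) :=
  hg.continuousOn.integrableOn_compact (isCompact_hull K.1)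

open Classical in
/-- The divergence theorem summed over the mesh: the contributions of the two sides of a facet combine
to a jump, because their outer normals are opposite. -/
theorem sum_cellIntegral_fderiv (hd : 1 ≤ d) (o : FacetOrientation T)
    (f : T.cells → EuclideanSpace ℝ (Fin d) → ℝ) (hf : ∀ K, ContDiff ℝ 1 (f K))
    (e : EuclideanSpace ℝ (Fin d)) :
    ∑ K : T.cells, cellIntegral K (fun x => fderiv ℝ (f K) x e) =
      ∑ F : T.facets, inner ℝ e (o.normal F) * facetIntegral F (fun x =>
        f (o.plus F) x - ∑ K ∈ (T.adjacent F).erase (o.plus F), f K x) := by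
  let g : T.cells → Finset (EuclideanSpace ℝ (Fin d)) → ℝ := fun K S =>
    if h : S ∈ T.facets then
      inner ℝ e (facetSign o K ⟨S, h⟩ • o.normal ⟨S, h⟩) * facetIntegral ⟨S, h⟩ (f K) else 0
  have hc : ∀ K : T.cells, ∀ a ∈ K.1, K.1.erase a ∈ T.facets := fun K a ha =>
    subset_mem_facets K.2 (Finset.erase_subset _ _)
      (by rw [Finset.card_erase_of_mem ha, T.card_eq K.1 K.2]; rfl)
  have h1 : ∀ K : T.cells, cellIntegral K (fun x => fderiv ℝ (f K) x e) =
      ∑ a ∈ K.1, g K (K.1.erase a) := by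
    intro K
    let ν : EuclideanSpace ℝ (Fin d) → EuclideanSpace ℝ (Fin d) := fun a =>
      if h : K.1.erase a ∈ T.facets then facetSign o K ⟨_, h⟩ • o.normal ⟨_, h⟩ else 0
    have hν : ∀ a (ha : a ∈ K.1), ν a =
        facetSign o K ⟨_, hc K a ha⟩ • o.normal ⟨_, hc K a ha⟩ := fun a ha => dif_pos (hc K a ha)
    have := integral_fderiv_simplex K.1 (T.indep K.1 K.2)
      (by rw [T.card_eq K.1 K.2, finrank_euclideanSpace_fin]) ν ?_ ?_ ?_ (hf K) e
    · rw [cellIntegral, this]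
      refine Finset.sum_congr rfl fun a ha => ?_
      rw [hν a ha, finrank_euclideanSpace_fin]
      simp only [g, dif_pos (hc K a ha)]
      rfl
    · intro a ha
      rw [hν a ha, norm_facetSign_smul]
    · intro a ha x hx y hy
      rw [hν a ha, inner_smul_right, o.normal_orthogonal ⟨_, hc K a ha⟩ x hx y hy, mul_zero]
    · intro a ha x hx
      rw [hν a ha]
      exact facetSign_outward o (F := ⟨_, hc K a ha⟩)
        (mem_adjacent.2 (Finset.erase_subset _ _)) x hx a ha (Finset.notMem_erase _ _)
  rw [Finset.sum_congr rfl fun K _ => h1 K, sum_cells_sum_erase]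
  refine Finset.sum_congr rfl fun F _ => ?_
  have h2 : ∀ K, g K F.1 = inner ℝ e (o.normal F) * (facetSign o K F * facetIntegral F (f K)) := by
    intro K
    simp only [g, dif_pos F.2, inner_smul_right]
    ring
  have h3 : facetIntegral F (fun x =>
        f (o.plus F) x - ∑ K ∈ (T.adjacent F).erase (o.plus F), f K x) =
      facetIntegral F (f (o.plus F)) -
        ∑ K ∈ (T.adjacent F).erase (o.plus F), facetIntegral F (f K) := by
    unfold facetIntegral
    rw [integral_sub (integrableOn_facet hd F (hf _).continuous), integral_finsetSum]
    · exact fun K _ => integrableOn_facet hd F (hf K).continuous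
    · exact integrable_finsetSum _ fun K _ => integrableOn_facet hd F (hf K).continuous
  rw [Finset.sum_congr rfl fun K _ => h2 K, ← Finset.mul_sum, h3,
    ← Finset.add_sum_erase _ _ (o.plus_mem F)]
  congr 1
  rw [sub_eq_add_neg, ← Finset.sum_neg_distrib]
  congr 1
  · simp [facetSign]
  · refine Finset.sum_congr rfl fun K hK => ?_
    simp [facetSign, (Finset.mem_erase.1 hK).1]

/-! ### Polynomials on cells -/

theorem contDiff_eval (p : MvPolynomial (Fin d) ℝ) {n : WithTop ℕ∞} :
    ContDiff ℝ n (fun x : EuclideanSpace ℝ (Fin d) => MvPolynomial.eval (fun i => x i) p) := by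
  induction p using MvPolynomial.induction_on with
  | C a => simpa using contDiff_const
  | add p q hp hq => simpa using hp.add hq
  | mul_X p i hp =>
    have : ContDiff ℝ n (fun x : EuclideanSpace ℝ (Fin d) => x i) := by fun_prop
    simpa using hp.mul this

theorem fderiv_eval (p : MvPolynomial (Fin d) ℝ) (x e : EuclideanSpace ℝ (Fin d)) :
    fderiv ℝ (fun x : EuclideanSpace ℝ (Fin d) => MvPolynomial.eval (fun i => x i) p) x e =
      ∑ j, MvPolynomial.eval (fun i => x i) (MvPolynomial.pderiv j p) * e j := by
  induction p using MvPolynomial.induction_on with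
  | C a => simp
  | add p q hp hq =>
    simp only [map_add, add_mul, Finset.sum_add_distrib]
    rw [fderiv_fun_add ((contDiff_eval p (n := 1)).differentiable one_ne_zero x)
      ((contDiff_eval q (n := 1)).differentiable one_ne_zero x), ← hp, ← hq]
    rfl
  | mul_X p i hp =>
    have h1 : DifferentiableAt ℝ (fun x : EuclideanSpace ℝ (Fin d) => x i) x := by fun_prop
    have h2 : fderiv ℝ (fun x : EuclideanSpace ℝ (Fin d) => x i) x e = e i := by
      have : HasFDerivAt (fun x : EuclideanSpace ℝ (Fin d) => x i)
        (EuclideanSpace.proj i : EuclideanSpace ℝ (Fin d) →L[ℝ] ℝ) x :=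
        (EuclideanSpace.proj i : EuclideanSpace ℝ (Fin d) →L[ℝ] ℝ).hasFDerivAt
      rw [this.fderiv]; rfl
    simp only [map_mul, MvPolynomial.eval_X, Derivation.leibniz, smul_eq_mul, map_add,
      MvPolynomial.pderiv_X]
    rw [fderiv_fun_mul ((contDiff_eval p (n := 1)).differentiable one_ne_zero x) h1]
    simp only [add_apply, smul_apply, smul_eq_mul, h2, hp,
      add_mul, Finset.sum_add_distrib, Finset.mul_sum]
    congr 1
    · rw [Finset.sum_eq_single i] <;> simp +contextual
    · exact Finset.sum_congr rfl fun j _ => by ring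

theorem contDiff_evalAt {m : ℕ} (p : Poly d m) {n : WithTop ℕ∞} : ContDiff ℝ n (evalAt p) :=
  contDiff_eval p.1

theorem continuous_evalAt {m : ℕ} (p : Poly d m) : Continuous (evalAt p) :=
  (contDiff_evalAt p (n := 0)).continuous

theorem continuous_partialAt {m : ℕ} (p : Poly d m) (j : Fin d) : Continuous (partialAt p j) :=
  (contDiff_eval (MvPolynomial.pderiv j p.1) (n := 0)).continuous

theorem fderiv_evalAt {m : ℕ} (p : Poly d m) (x e : EuclideanSpace ℝ (Fin d)) :
    fderiv ℝ (evalAt p) x e = ∑ j, partialAt p j x * e j :=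
  fderiv_eval p.1 x e

theorem fderiv_evalAt_single {m : ℕ} (p : Poly d m) (x : EuclideanSpace ℝ (Fin d)) (j : Fin d) :
    fderiv ℝ (evalAt p) x (EuclideanSpace.single j 1) = partialAt p j x := by
  rw [fderiv_evalAt, Finset.sum_eq_single j] <;> simp +contextual

theorem totalDegree_pderiv_le (j : Fin d) (p : MvPolynomial (Fin d) ℝ) :
    (MvPolynomial.pderiv j p).totalDegree ≤ p.totalDegree := by
  conv_lhs => rw [p.as_sum, map_sum]
  refine MvPolynomial.totalDegree_finsetSum_le fun s hs => ?_
  rw [MvPolynomial.pderiv_monomial]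
  refine (MvPolynomial.totalDegree_monomial_le _ _).trans
    (le_trans ?_ (MvPolynomial.le_totalDegree hs))
  exact Finsupp.degree_mono tsub_le_self

/-- The partial derivative of a polynomial of degree at most `m`, again as such a polynomial. -/
noncomputable def partialPoly {m : ℕ} (j : Fin d) (p : Poly d m) : Poly d m :=
  ⟨MvPolynomial.pderiv j p.1, by
    rw [MvPolynomial.mem_restrictTotalDegree]
    exact (totalDegree_pderiv_le j p.1).trans ((MvPolynomial.mem_restrictTotalDegree _ _ _).1 p.2)⟩

theorem evalAt_partialPoly {m : ℕ} (j : Fin d) (p : Poly d m) :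
    evalAt (partialPoly j p) = partialAt p j := rfl

/-- A polynomial that vanishes on a nonempty open set is zero. -/
theorem poly_eq_zero_of_open {m : ℕ} (p : Poly d m) {U : Set (EuclideanSpace ℝ (Fin d))}
    (hU : IsOpen U) (hne : U.Nonempty) (h : ∀ x ∈ U, evalAt p x = 0) : p = 0 := by
  obtain ⟨x, hx⟩ := hne
  have hc : Continuous (WithLp.toLp 2 : (Fin d → ℝ) → EuclideanSpace ℝ (Fin d)) := by fun_prop
  have hV : IsOpen (WithLp.toLp 2 ⁻¹' U : Set (Fin d → ℝ)) := hU.preimage hc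
  obtain ⟨ε, hε, hb⟩ := Metric.isOpen_iff.1 hV x.ofLp (by simpa using hx)
  refine Subtype.ext ?_
  refine MvPolynomial.funext_set (fun i => Metric.ball (x i) ε) (fun i => ?_) fun y hy => ?_
  · rw [Real.ball_eq_Ioo]
    exact Set.Ioo_infinite (by linarith)
  · rw [ball_pi _ hε] at hb
    have := h (WithLp.toLp 2 y) (hb hy)
    simpa [evalAt] using this

theorem interior_cell_nonempty (K : T.cells) : (interior (hull K.1)).Nonempty := by
  have h1 := (T.indep K.1 K.2).affineSpan_eq_top_iff_card_eq_finrank_add_one.2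
    (by simpa [finrank_euclideanSpace_fin] using T.card_eq K.1 K.2)
  rw [interior_convexHull_nonempty_iff_affineSpan_eq_top]
  simpa using h1

theorem volume_cell_frontier (K : T.cells) : volume (frontier (hull K.1)) = 0 :=
  (convex_convexHull ℝ _).addHaar_frontier volume

theorem interior_cell_subset (hΩ : interior (closure Ω) = Ω) (K : T.cells) :
    interior (hull K.1) ⊆ Ω := by
  conv_rhs => rw [← hΩ]
  refine interior_mono ?_
  rw [← T.cover]
  exact Set.subset_iUnion₂_of_subset K.1 K.2 subset_rfl

theorem interior_cell_ae_eq (K : T.cells) :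
    interior (hull K.1) =ᵐ[volume] hull K.1 :=
  interior_ae_eq_of_null_frontier (volume_cell_frontier K)

theorem poly_eq_zero_of_ae_cell {m : ℕ} (p : Poly d m) (K : T.cells)
    (h : ∀ᵐ x ∂(volume.restrict (hull K.1)), evalAt p x = 0) : p = 0 := by
  refine poly_eq_zero_of_open p isOpen_interior (interior_cell_nonempty K) ?_
  have h1 : evalAt p =ᵐ[volume.restrict (interior (hull K.1))] fun _ => 0 :=
    ae_mono (Measure.restrict_mono interior_subset le_rfl) h
  exact Measure.eqOn_open_of_ae_eq h1 isOpen_interior (continuous_evalAt p).continuousOn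
    continuousOn_const

theorem cellIntegral_sq_eq_zero (K : T.cells) {g : EuclideanSpace ℝ (Fin d) → ℝ} (hg : Continuous g) :
    cellIntegral K (fun x => g x ^ 2) = 0 ↔ ∀ᵐ x ∂(volume.restrict (hull K.1)), g x = 0 := by
  rw [cellIntegral, integral_eq_zero_iff_of_nonneg (fun x => sq_nonneg _)
    (integrableOn_cell K (hg.pow 2))]
  simp [Filter.EventuallyEq]

theorem facetIntegral_sq_eq_zero (hd : 1 ≤ d) (F : T.facets) {g : EuclideanSpace ℝ (Fin d) → ℝ}
    (hg : Continuous g) : facetIntegral F (fun x => g x ^ 2) = 0 ↔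
      ∀ᵐ x ∂((Measure.euclideanHausdorffMeasure (d - 1)).restrict (hull F.1)), g x = 0 := by
  rw [facetIntegral, integral_eq_zero_iff_of_nonneg (fun x => sq_nonneg _)
    (integrableOn_facet hd F (hg.pow 2))]
  simp [Filter.EventuallyEq]

theorem facetDiam_pos (hd : 2 ≤ d) (F : T.facets) : 0 < facetDiam F := by
  obtain ⟨x, hx, y, hy, hxy⟩ := Finset.one_lt_card.1 (by rw [card_facet]; omega : 1 < F.1.card)
  exact (dist_pos.2 hxy).trans_le (Metric.dist_le_diam_of_mem (isCompact_hull F.1).isBounded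
    (subset_convexHull ℝ _ hx) (subset_convexHull ℝ _ hy))

theorem continuous_localVal (v : VelSpace T k) (K : T.cells) : Continuous (localVal v K) :=
  (PiLp.continuous_toLp 2 _).comp (continuous_pi fun i => continuous_evalAt (v K i))

theorem continuous_localDiv (v : VelSpace T k) (K : T.cells) : Continuous (localDiv v K) :=
  continuous_finsetSum _ fun i _ => continuous_partialAt _ i

theorem continuous_jump (o : FacetOrientation T) (v : VelSpace T k) (F : T.facets) :
    Continuous (jump o v F) :=
  (continuous_localVal v _).sub (continuous_finsetSum _ fun K _ => continuous_localVal v K)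

theorem continuous_normalJump (o : FacetOrientation T) (v : VelSpace T k) (F : T.facets) :
    Continuous (normalJump o v F) :=
  (continuous_jump o v F).inner continuous_const

theorem continuous_average (F : T.facets) {φ : T.cells → EuclideanSpace ℝ (Fin d) → ℝ}
    (h : ∀ K, Continuous (φ K)) : Continuous fun x => average F (fun K => φ K x) :=
  continuous_const.mul (continuous_finsetSum _ fun K _ => h K)

open Classical in
theorem jump_apply (o : FacetOrientation T) (v : VelSpace T k) (F : T.facets)
    (x : EuclideanSpace ℝ (Fin d)) (i : Fin d) :
    jump o v F x i = evalAt (v (o.plus F) i) x -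
      ∑ K ∈ (T.adjacent F).erase (o.plus F), evalAt (v K i) x := by
  simp [jump, localVal]

/-- Elementwise integration by parts against a test function: only the normal jumps remain. -/
theorem sum_cellIntegral_test (hd : 1 ≤ d) (o : FacetOrientation T) (v : VelSpace T k)
    {φ : EuclideanSpace ℝ (Fin d) → ℝ} (hφ : ContDiff ℝ 1 φ) :
    ∑ K : T.cells, cellIntegral K (fun x => fderiv ℝ φ x (localVal v K x) + localDiv v K x * φ x) =
      ∑ F : T.facets, facetIntegral F (fun x => normalJump o v F x * φ x) := by
  classical
  have hf : ∀ i K, ContDiff ℝ 1 (fun x => evalAt (v K i) x * φ x) := fun i K =>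
    (contDiff_evalAt (v K i)).mul hφ
  have h1 : ∀ K : T.cells, ∀ x, fderiv ℝ φ x (localVal v K x) + localDiv v K x * φ x =
      ∑ i, fderiv ℝ (fun x => evalAt (v K i) x * φ x) x (EuclideanSpace.single i 1) := by
    intro K x
    have e1 : localVal v K x = ∑ i, evalAt (v K i) x • EuclideanSpace.single i (1 : ℝ) := by
      ext j
      simp [localVal, Finset.sum_apply, Pi.single_apply]
    rw [e1, map_sum, localDiv, Finset.sum_mul, ← Finset.sum_add_distrib]
    refine Finset.sum_congr rfl fun i _ => ?_
    rw [fderiv_fun_mul ((contDiff_evalAt (v K i) (n := 1)).differentiable one_ne_zero x)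
      (hφ.differentiable one_ne_zero x)]
    simp only [add_apply, smul_apply, smul_eq_mul,
      fderiv_evalAt_single, map_smul]
    ring
  have h2 : ∀ F : T.facets, ∀ x, normalJump o v F x * φ x =
      ∑ i, inner ℝ (EuclideanSpace.single i (1 : ℝ)) (o.normal F) *
        (evalAt (v (o.plus F) i) x * φ x -
          ∑ K ∈ (T.adjacent F).erase (o.plus F), evalAt (v K i) x * φ x) := by
    intro F x
    rw [normalJump, PiLp.inner_apply, Finset.sum_mul]
    refine Finset.sum_congr rfl fun i _ => ?_
    rw [jump_apply, ← Finset.sum_mul, ← sub_mul]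
    simp [EuclideanSpace.inner_single_left]
    ring
  have hc : ∀ i (F : T.facets), Continuous fun x => (evalAt (v (o.plus F) i) x * φ x -
          ∑ K ∈ (T.adjacent F).erase (o.plus F), evalAt (v K i) x * φ x) := fun i F =>
    (hf i _).continuous.sub (continuous_finsetSum _ fun K _ => (hf i K).continuous)
  simp only [h1, h2]
  unfold cellIntegral facetIntegral
  have h3 : ∀ K : T.cells, ∫ x in hull K.1, ∑ i, fderiv ℝ (fun x => evalAt (v K i) x * φ x) x
      (EuclideanSpace.single i 1) = ∑ i, cellIntegral K (fun x =>
        fderiv ℝ (fun x => evalAt (v K i) x * φ x) x (EuclideanSpace.single i 1)) := by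
    intro K
    rw [integral_finsetSum]
    · rfl
    · exact fun i _ => integrableOn_cell K
        (((hf i K).continuous_fderiv one_ne_zero).clm_apply continuous_const)
  have h4 : ∀ F : T.facets, (∫ x in hull F.1, ∑ i,
      inner ℝ (EuclideanSpace.single i (1 : ℝ)) (o.normal F) *
        (evalAt (v (o.plus F) i) x * φ x -
          ∑ K ∈ (T.adjacent F).erase (o.plus F), evalAt (v K i) x * φ x)
        ∂(Measure.euclideanHausdorffMeasure (d - 1))) =
      ∑ i, inner ℝ (EuclideanSpace.single i (1 : ℝ)) (o.normal F) * facetIntegral F (fun x =>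
        (evalAt (v (o.plus F) i) x * φ x -
          ∑ K ∈ (T.adjacent F).erase (o.plus F), evalAt (v K i) x * φ x)) := by
    intro F
    rw [integral_finsetSum]
    · exact Finset.sum_congr rfl fun i _ => integral_const_mul _ _
    · exact fun i _ => (integrableOn_facet hd F (hc i F)).const_mul _
  rw [Finset.sum_congr rfl fun K _ => h3 K, Finset.sum_congr rfl fun F _ => h4 F, Finset.sum_comm,
    Finset.sum_comm (s := (Finset.univ : Finset T.facets))]
  exact Finset.sum_congr rfl fun i _ =>
    sum_cellIntegral_fderiv hd o (fun K x => evalAt (v K i) x * φ x) (hf i) _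

/-! ### Normal jumps and `H₀(div)` -/

open Classical in
/-- The function equal to `g K` in the interior of each cell `K`, and `0` on the skeleton. -/
noncomputable def piecewise {α : Type*} [AddCommMonoid α]
    (g : T.cells → EuclideanSpace ℝ (Fin d) → α) (x : EuclideanSpace ℝ (Fin d)) : α :=
  ∑ K : T.cells, if x ∈ interior (hull K.1) then g K x else 0

theorem piecewise_eq_sum_indicator {α : Type*} [AddCommMonoid α]
    (g : T.cells → EuclideanSpace ℝ (Fin d) → α) :
    piecewise g = fun x => ∑ K : T.cells, (interior (hull K.1)).indicator (g K) x := by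
  classical
  ext x
  simp only [piecewise, Set.indicator_apply]

theorem integral_piecewise (hΩ : interior (closure Ω) = Ω)
    (g : T.cells → EuclideanSpace ℝ (Fin d) → ℝ) (hg : ∀ K, Continuous (g K)) :
    ∫ x in Ω, piecewise g x = ∑ K : T.cells, cellIntegral K (g K) := by
  have h1 : ∀ K : T.cells, (volume.restrict Ω).restrict (interior (hull K.1)) =
      volume.restrict (interior (hull K.1)) := fun K => by
    rw [Measure.restrict_restrict isOpen_interior.measurableSet,
      Set.inter_eq_left.2 (interior_cell_subset hΩ K)]
  rw [piecewise_eq_sum_indicator, integral_finsetSum]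
  · refine Finset.sum_congr rfl fun K _ => ?_
    rw [integral_indicator isOpen_interior.measurableSet, h1, cellIntegral]
    exact setIntegral_congr_set (interior_cell_ae_eq K)
  · intro K _
    rw [integrable_indicator_iff isOpen_interior.measurableSet, IntegrableOn, h1]
    exact (integrableOn_cell K (hg K)).mono_set interior_subset

theorem memLp_piecewise (hΩ : interior (closure Ω) = Ω) {α : Type*} [NormedAddCommGroup α]
    [SecondCountableTopology α] (g : T.cells → EuclideanSpace ℝ (Fin d) → α)
    (hg : ∀ K, Continuous (g K)) : MemLp (piecewise g) 2 (volume.restrict Ω) := by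
  rw [piecewise_eq_sum_indicator]
  refine memLp_finsetSum _ fun K _ => ?_
  rw [memLp_indicator_iff_restrict isOpen_interior.measurableSet,
    Measure.restrict_restrict isOpen_interior.measurableSet,
      Set.inter_eq_left.2 (interior_cell_subset hΩ K)]
  obtain ⟨C, hC⟩ := (isCompact_hull K.1).exists_bound_of_continuousOn (hg K).continuousOn
  have : IsFiniteMeasure (volume.restrict (interior (hull K.1))) :=
    ⟨by
      rw [Measure.restrict_apply_univ]
      exact (measure_mono interior_subset).trans_lt (isCompact_hull K.1).measure_lt_top⟩
  refine MemLp.of_bound (hg K).aestronglyMeasurable C ?_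
  exact (ae_restrict_iff' isOpen_interior.measurableSet).2
    (Filter.Eventually.of_forall fun x hx => hC x (interior_subset hx))

theorem piecewise_mul (g : T.cells → EuclideanSpace ℝ (Fin d) → ℝ)
    (h : EuclideanSpace ℝ (Fin d) → ℝ) (x : EuclideanSpace ℝ (Fin d)) :
    piecewise g x * h x = piecewise (fun K x => g K x * h x) x := by
  simp only [piecewise, Finset.sum_mul, ite_mul, zero_mul]

theorem interior_cell_disjoint {K L : T.cells} (h : K ≠ L) {x : EuclideanSpace ℝ (Fin d)}
    (hK : x ∈ interior (hull K.1)) (hL : x ∈ interior (hull L.1)) : False := by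
  classical
  have h1 : interior (hull K.1) ∩ interior (hull L.1) ⊆ hull (K.1 ∩ L.1) := by
    refine (Set.inter_subset_inter interior_subset interior_subset).trans ?_
    rw [hull, hull, T.conforming K.1 K.2 L.1 L.2, hull, Finset.coe_inter]
  have hc : (K.1 ∩ L.1).card ≤ d := by
    by_contra hlt
    have h2 : K.1 ∩ L.1 = K.1 := Finset.eq_of_subset_of_card_le Finset.inter_subset_left
      (by rw [T.card_eq K.1 K.2]; omega)
    have h3 : K.1 ∩ L.1 = L.1 := Finset.eq_of_subset_of_card_le Finset.inter_subset_right
      (by rw [T.card_eq L.1 L.2]; omega)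
    exact h (Subtype.ext (h2.symm.trans h3))
  have h2 := euclideanHausdorffMeasure_convexHull_eq_zero (K.1 ∩ L.1) hc
  rw [EuclideanSpace.euclideanHausdorffMeasure_eq_volume] at h2
  exact (isOpen_interior.inter isOpen_interior).measure_ne_zero volume ⟨x, hK, hL⟩
    (measure_mono_null h1 h2)

theorem piecewise_mul_piecewise (g h : T.cells → EuclideanSpace ℝ (Fin d) → ℝ)
    (x : EuclideanSpace ℝ (Fin d)) :
    piecewise g x * piecewise h x = piecewise (fun K x => g K x * h K x) x := by
  classical
  rw [piecewise_mul]
  simp only [piecewise]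
  refine Finset.sum_congr rfl fun K _ => ?_
  split_ifs with hK
  · congr 1
    rw [Finset.sum_eq_single K, if_pos hK]
    · intro L _ hL
      exact if_neg fun hx => interior_cell_disjoint hL hx hK
    · simp
  · rfl

theorem fderiv_velFun (v : VelSpace T k) (φ : EuclideanSpace ℝ (Fin d) → ℝ)
    (x : EuclideanSpace ℝ (Fin d)) :
    fderiv ℝ φ x (velFun v x) = piecewise (fun K x => fderiv ℝ φ x (localVal v K x)) x := by
  simp only [velFun, piecewise, map_sum]
  refine Finset.sum_congr rfl fun K _ => ?_
  split_ifs <;> simp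

/-- The normal trace of a piecewise polynomial field, defined with its elementwise divergence, is the
sum of the normal jumps over all facets. -/
theorem normalTrace_velFun (hd : 1 ≤ d) (hΩ : interior (closure Ω) = Ω) (o : FacetOrientation T)
    (v : VelSpace T k) {φ : EuclideanSpace ℝ (Fin d) → ℝ} (hφ : ContDiff ℝ ∞ φ) :
    (∫ x in Ω, fderiv ℝ φ x (velFun v x)) + ∫ x in Ω, piecewise (localDiv v) x * φ x =
      ∑ F : T.facets, facetIntegral F (fun x => normalJump o v F x * φ x) := by
  have hφ1 : ContDiff ℝ 1 φ := hφ.of_le (by exact_mod_cast le_top)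
  have c1 : ∀ K : T.cells, Continuous fun x => fderiv ℝ φ x (localVal v K x) := fun K =>
    (hφ1.continuous_fderiv one_ne_zero).clm_apply (continuous_localVal v K)
  have c2 : ∀ K : T.cells, Continuous fun x => localDiv v K x * φ x := fun K =>
    (continuous_localDiv v K).mul hφ1.continuous
  simp only [fderiv_velFun, piecewise_mul]
  rw [integral_piecewise hΩ _ c1, integral_piecewise hΩ _ c2, ← Finset.sum_add_distrib,
    ← sum_cellIntegral_test hd o v hφ1]
  refine Finset.sum_congr rfl fun K _ => ?_
  exact (integral_add (integrableOn_cell K (c1 K)) (integrableOn_cell K (c2 K))).symm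

/-- The normal jumps of `v` vanish almost everywhere on every facet. -/
def NormalContinuous (o : FacetOrientation T) (v : VelSpace T k) : Prop :=
  ∀ F : T.facets, ∀ᵐ x ∂((Measure.euclideanHausdorffMeasure (d - 1)).restrict (hull F.1)),
    normalJump o v F x = 0

theorem NormalContinuous.facetIntegral_eq_zero {o : FacetOrientation T} {v : VelSpace T k}
    (h : NormalContinuous o v) (F : T.facets) (g : EuclideanSpace ℝ (Fin d) → ℝ) :
    facetIntegral F (fun x => g x * normalJump o v F x) = 0 := by
  refine integral_eq_zero_of_ae ?_
  filter_upwards [h F] with x hx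
  simp [hx]

theorem NormalContinuous.normalTrace_eq_zero (hd : 1 ≤ d) (hΩ : interior (closure Ω) = Ω)
    {o : FacetOrientation T} {v : VelSpace T k} (h : NormalContinuous o v)
    {φ : EuclideanSpace ℝ (Fin d) → ℝ} (hφ : ContDiff ℝ ∞ φ) :
    (∫ x in Ω, fderiv ℝ φ x (velFun v x)) + ∫ x in Ω, piecewise (localDiv v) x * φ x = 0 := by
  rw [normalTrace_velFun hd hΩ o v hφ]
  refine Finset.sum_eq_zero fun F _ => ?_
  simp only [mul_comm _ (φ _)]
  exact h.facetIntegral_eq_zero F φ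

theorem NormalContinuous.isWeakDiv (hd : 1 ≤ d) (hΩ : interior (closure Ω) = Ω)
    {o : FacetOrientation T} {v : VelSpace T k} (h : NormalContinuous o v) :
    IsWeakDiv Ω (velFun v) (piecewise (localDiv v)) := by
  refine ⟨memLp_piecewise hΩ _ (continuous_localDiv v), fun φ hφ _ _ => ?_⟩
  have := h.normalTrace_eq_zero hd hΩ hφ
  linarith

theorem NormalContinuous.mem_BDM (hd : 1 ≤ d) (hΩ : interior (closure Ω) = Ω)
    {o : FacetOrientation T} {v : VelSpace T k} (h : NormalContinuous o v) : v ∈ BDM T k :=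
  ⟨memLp_piecewise hΩ _ (continuous_localVal v), piecewise (localDiv v), h.isWeakDiv hd hΩ,
    fun _ hφ _ => h.normalTrace_eq_zero hd hΩ hφ⟩

/-- For fields without normal jumps the facet terms of `b_h` vanish, so that discretely
divergence-free means divergence-free against `Q_h`. -/
theorem NormalContinuous.mem_WDiv (hd : 1 ≤ d) (hΩ : interior (closure Ω) = Ω)
    {o : FacetOrientation T} {v : VelSpace T k} (h : NormalContinuous o v) (hv : v ∈ VDiv o k) :
    v ∈ WDiv T k := by
  refine ⟨h.mem_BDM hd hΩ, _, h.isWeakDiv hd hΩ, fun q hq => ?_⟩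
  have h1 : ∫ x in Ω, scalarFun q x * piecewise (localDiv v) x =
      ∑ K : T.cells, cellIntegral K fun x => evalAt (q K) x * localDiv v K x := by
    have h2 : ∀ x, scalarFun q x * piecewise (localDiv v) x =
      piecewise (fun K x => evalAt (q K) x * localDiv v K x) x := fun x =>
      piecewise_mul_piecewise (fun K => evalAt (q K)) (localDiv v) x
    simp only [h2]
    exact integral_piecewise hΩ _ fun K => (continuous_evalAt _).mul (continuous_localDiv v K)
  have h3 := hv q hq
  rw [bForm, Finset.sum_eq_zero fun F _ => h.facetIntegral_eq_zero F _, add_zero] at h3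
  rw [h1, h3]

theorem hull_facet_inter_subset (F F' : T.facets) :
    hull F.1 ∩ hull F'.1 ⊆ hull (F.1 ∩ F'.1) := by
  obtain ⟨K, hK, hFK⟩ := Finset.mem_biUnion.1 F.2
  obtain ⟨K', hK', hFK'⟩ := Finset.mem_biUnion.1 F'.2
  replace hFK := (Finset.mem_powersetCard.1 hFK).1
  replace hFK' := (Finset.mem_powersetCard.1 hFK').1
  rintro x ⟨hx, hx'⟩
  have h1 : x ∈ hull (K ∩ K') := by
    rw [hull, Finset.coe_inter, ← T.conforming K hK K' hK']
    exact ⟨convexHull_mono (Finset.coe_subset.2 hFK) hx,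
      convexHull_mono (Finset.coe_subset.2 hFK') hx'⟩
  have h2 : x ∈ hull (F.1 ∩ K') := by
    have := (T.indep K hK).convexHull_inter hFK (Finset.inter_subset_left (s₂ := K'))
    have h3 : x ∈ convexHull ℝ ((F.1 : Set _) ∩ ((K ∩ K' : Finset _) : Set _)) := by
      rw [this]; exact ⟨hx, h1⟩
    refine convexHull_mono ?_ h3
    intro y hy
    simp only [Finset.coe_inter, Set.mem_inter_iff, Finset.mem_coe] at hy ⊢
    exact ⟨hy.1, hy.2.2⟩
  have := (T.indep K' hK').convexHull_inter (Finset.inter_subset_right (s₁ := F.1)) hFK'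
  have h3 : x ∈ convexHull ℝ (((F.1 ∩ K' : Finset _) : Set _) ∩ (F'.1 : Set _)) := by
    rw [this]; exact ⟨h2, hx'⟩
  refine convexHull_mono ?_ h3
  intro y hy
  simp only [Finset.coe_inter, Set.mem_inter_iff, Finset.mem_coe] at hy ⊢
  exact ⟨hy.1.1, hy.2⟩

theorem measure_facet_inter (hd : 1 ≤ d) {F F' : T.facets} (h : F ≠ F') :
    Measure.euclideanHausdorffMeasure (d - 1) (hull F.1 ∩ hull F'.1) = 0 := by
  refine measure_mono_null (hull_facet_inter_subset F F')
    (euclideanHausdorffMeasure_convexHull_eq_zero _ ?_)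
  by_contra hlt
  have h2 : F.1 ∩ F'.1 = F.1 := Finset.eq_of_subset_of_card_le Finset.inter_subset_left
    (by rw [card_facet]; omega)
  have h3 : F.1 ∩ F'.1 = F'.1 := Finset.eq_of_subset_of_card_le Finset.inter_subset_right
    (by rw [card_facet]; omega)
  exact h (Subtype.ext (h2.symm.trans h3))

/-- The functional `φ ↦ ∑_F ∫_F j_F φ` determines the facet functions `j_F`, because distinct facets
overlap in null sets. -/
theorem ae_eq_zero_of_sum_facetIntegral (hd : 1 ≤ d) (j : T.facets → EuclideanSpace ℝ (Fin d) → ℝ)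
    (hj : ∀ F, Continuous (j F))
    (h : ∀ φ : EuclideanSpace ℝ (Fin d) → ℝ, ContDiff ℝ ∞ φ → HasCompactSupport φ →
      ∑ F : T.facets, facetIntegral F (fun x => j F x * φ x) = 0) (F : T.facets) :
    ∀ᵐ x ∂((Measure.euclideanHausdorffMeasure (d - 1)).restrict (hull F.1)), j F x = 0 := by
  set S : Set (EuclideanSpace ℝ (Fin d)) := ⋃ F : T.facets, hull F.1 with hS
  set ν := (Measure.euclideanHausdorffMeasure (d - 1) :
    Measure (EuclideanSpace ℝ (Fin d))).restrict S with hν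
  have hm : ∀ F : T.facets, MeasurableSet (hull F.1) := fun F => (isCompact_hull F.1).measurableSet
  have hFS : ∀ F : T.facets, hull F.1 ⊆ S := fun F =>
    Set.subset_iUnion (fun F : T.facets => hull F.1) F
  have hνF : ∀ F : T.facets, ν.restrict (hull F.1) =
      (Measure.euclideanHausdorffMeasure (d - 1)).restrict (hull F.1) := fun F => by
    rw [hν, Measure.restrict_restrict (hm F), Set.inter_eq_left.2 (hFS F)]
  have hI : ∀ (F : T.facets) (g : EuclideanSpace ℝ (Fin d) → ℝ), Continuous g →
      Integrable ((hull F.1).indicator g) ν := fun F g hg => by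
    rw [integrable_indicator_iff (hm F), IntegrableOn, hνF]
    exact integrableOn_facet hd F hg
  have key : ∀ᵐ x ∂ν, ∑ F : T.facets, (hull F.1).indicator (j F) x = 0 := by
    refine ae_eq_zero_of_integral_contDiff_smul_eq_zero
      (integrable_finsetSum _ fun F _ => hI F _ (hj F)).locallyIntegrable fun φ hφ hc => ?_
    rw [← h φ hφ hc]
    have h1 : ∀ x, φ x • ∑ F : T.facets, (hull F.1).indicator (j F) x =
        ∑ F : T.facets, (hull F.1).indicator (fun x => j F x * φ x) x := fun x => by
      rw [smul_eq_mul, Finset.mul_sum]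
      refine Finset.sum_congr rfl fun F _ => ?_
      by_cases hx : x ∈ hull F.1 <;> simp [hx, mul_comm]
    simp only [h1]
    rw [integral_finsetSum _ fun F _ => hI F (fun x => j F x * φ x) ((hj F).mul hφ.continuous)]
    refine Finset.sum_congr rfl fun F _ => ?_
    rw [integral_indicator (hm F), hνF, facetIntegral]
  have h2 : ∀ᵐ x ∂(ν.restrict (hull F.1)), ∑ F : T.facets, (hull F.1).indicator (j F) x = 0 :=
    ae_restrict_of_ae key
  rw [hνF] at h2
  have h3 : ∀ᵐ x ∂((Measure.euclideanHausdorffMeasure (d - 1)).restrict (hull F.1)),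
      ∀ F' : T.facets, F' ≠ F → x ∉ hull F'.1 := by
    rw [ae_all_iff]
    intro F'
    by_cases hne : F' = F
    · simp [hne]
    · have h4 := measure_facet_inter hd hne
      rw [← Measure.restrict_apply (hm F')] at h4
      filter_upwards [measure_eq_zero_iff_ae_notMem.1 h4] with x hx _ using hx
  filter_upwards [h2, h3, ae_restrict_mem (hm F)] with x h5 h6 h7
  rw [Finset.sum_eq_single F, Set.indicator_of_mem h7] at h5
  · exact h5
  · exact fun F' _ hne => Set.indicator_of_notMem (h6 F' hne) _
  · simp

/-- A piecewise polynomial field in `H₀(div)` has no normal jumps. Test functions supported off the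
skeleton identify its weak divergence; the remaining identity involves facet integrals only. -/
theorem normalContinuous_of_mem_HZeroDiv (hd : 1 ≤ d) (hΩ : interior (closure Ω) = Ω)
    (hΩo : IsOpen Ω) (o : FacetOrientation T) (v : VelSpace T k) (hv : velFun v ∈ HZeroDiv Ω) :
    NormalContinuous o v := by
  obtain ⟨-, s, ⟨hs, -⟩, hφ0⟩ := hv
  have hfin : IsFiniteMeasure (volume.restrict Ω) := by
    refine ⟨?_⟩
    rw [Measure.restrict_apply_univ]
    refine (measure_mono subset_closure).trans_lt (IsCompact.measure_lt_top ?_)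
    rw [← T.cover]
    exact T.cells.isCompact_biUnion fun K _ => isCompact_hull K
  have hs1 : Integrable s (volume.restrict Ω) := hs.integrable one_le_two
  have hp1 : Integrable (piecewise (localDiv v)) (volume.restrict Ω) :=
    (memLp_piecewise hΩ _ (continuous_localDiv v)).integrable one_le_two
  set g : EuclideanSpace ℝ (Fin d) → ℝ := Ω.indicator (fun x => piecewise (localDiv v) x - s x)
    with hg
  have hgint : Integrable g := (integrable_indicator_iff hΩo.measurableSet).2 (hp1.sub hs1)
  have hid : ∀ φ : EuclideanSpace ℝ (Fin d) → ℝ, ContDiff ℝ ∞ φ → HasCompactSupport φ →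
      ∫ x, φ x • g x = ∑ F : T.facets, facetIntegral F (fun x => normalJump o v F x * φ x) := by
    intro φ hφ hc
    obtain ⟨C, hC⟩ := hc.exists_bound_of_continuous hφ.continuous
    have hmul : ∀ {u : EuclideanSpace ℝ (Fin d) → ℝ}, Integrable u (volume.restrict Ω) →
        Integrable (fun x => u x * φ x) (volume.restrict Ω) := fun hu =>
      hu.mul_bdd hφ.continuous.aestronglyMeasurable (Filter.Eventually.of_forall hC)
    have h1 : ∀ x, φ x • g x =
        Ω.indicator (fun x => piecewise (localDiv v) x * φ x - s x * φ x) x := fun x => by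
      by_cases hx : x ∈ Ω
      · simp [hg, hx]; ring
      · simp [hg, hx]
    simp only [h1]
    rw [integral_indicator hΩo.measurableSet, integral_sub (hmul hp1) (hmul hs1),
      ← normalTrace_velFun hd hΩ o v hφ]
    linarith [hφ0 φ hφ hc]
  have hskel : IsClosed (⋃ F : T.facets, hull F.1) :=
    isClosed_iUnion_of_finite fun F => (isCompact_hull F.1).isClosed
  have hnull : volume (⋃ F : T.facets, hull F.1) = 0 := by
    refine measure_iUnion_null fun F => ?_
    rw [← EuclideanSpace.euclideanHausdorffMeasure_eq_volume]
    exact euclideanHausdorffMeasure_convexHull_eq_zero F.1 (card_facet F).le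
  -- the skeleton is a null set, so test functions supported off it suffice
  have hg0 : ∀ᵐ x, g x = 0 := by
    have h1 := hskel.isOpen_compl.ae_eq_zero_of_integral_contDiff_smul_eq_zero
      (hgint.locallyIntegrable.locallyIntegrableOn _) fun φ hφ hc hsupp => by
        rw [hid φ hφ hc]
        refine Finset.sum_eq_zero fun F _ => ?_
        refine setIntegral_eq_zero_of_forall_eq_zero fun x hx => ?_
        have : x ∉ tsupport φ := fun h => hsupp h (Set.mem_iUnion.2 ⟨F, hx⟩)
        rw [image_eq_zero_of_notMem_tsupport this, mul_zero]
    filter_upwards [h1, measure_eq_zero_iff_ae_notMem.1 hnull] with x hx hx' using hx hx'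
  refine ae_eq_zero_of_sum_facetIntegral hd _ (continuous_normalJump o v) fun φ hφ hc => ?_
  rw [← hid φ hφ hc]
  refine integral_eq_zero_of_ae ?_
  filter_upwards [hg0] with x hx
  simp [hx]

/-! ### The energy norm -/

theorem cellIntegral_nonneg (K : T.cells) {g : EuclideanSpace ℝ (Fin d) → ℝ} (hg : ∀ x, 0 ≤ g x) :
    0 ≤ cellIntegral K g := integral_nonneg hg

theorem facetIntegral_nonneg (F : T.facets) {g : EuclideanSpace ℝ (Fin d) → ℝ}
    (hg : ∀ x, 0 ≤ g x) : 0 ≤ facetIntegral F g := integral_nonneg hg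

theorem gradForm_self (v : VelSpace T k) :
    gradForm v v = ∑ K : T.cells, ∑ i, ∑ j, cellIntegral K (fun x => partialAt (v K i) j x ^ 2) := by
  unfold gradForm
  refine Finset.sum_congr rfl fun K _ => ?_
  have hc : ∀ i j, Continuous fun x => partialAt (v K i) j x ^ 2 := fun i j =>
    (continuous_partialAt _ _).pow 2
  simp only [cellIntegral, ← pow_two]
  rw [integral_finsetSum]
  · refine Finset.sum_congr rfl fun i _ => ?_
    rw [integral_finsetSum]
    exact fun j _ => integrableOn_cell K (hc i j)
  · exact fun i _ => integrableOn_cell K (continuous_finsetSum _ fun j _ => hc i j)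

/-- The energy norm is definite. For a piecewise constant `v` without jumps, the divergence theorem
for `x₁ vᵢ²` in the first coordinate direction gives `∫ vᵢ² = 0`. -/
theorem eq_zero_of_energySq_eq_zero (hd : 2 ≤ d) (o : FacetOrientation T) {σ : ℝ} (hσ : 0 < σ)
    (v : VelSpace T k) (h : energySq o σ v = 0) : v = 0 := by
  classical
  have hg0 : ∀ K i j, 0 ≤ cellIntegral K (fun x => partialAt (v K i) j x ^ 2) := fun K i j =>
    cellIntegral_nonneg K fun x => sq_nonneg _
  have hj0 : ∀ F : T.facets, 0 ≤ σ / facetDiam F * facetIntegral F (fun x => ‖jump o v F x‖ ^ 2) :=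
    fun F => mul_nonneg (div_nonneg hσ.le (facetDiam_pos hd F).le)
      (facetIntegral_nonneg F fun x => sq_nonneg _)
  have hG0 : 0 ≤ gradForm v v := by
    rw [gradForm_self]
    exact Finset.sum_nonneg fun K _ => Finset.sum_nonneg fun i _ =>
      Finset.sum_nonneg fun j _ => hg0 K i j
  have hJ0 := Finset.sum_nonneg fun (F : T.facets) (_ : F ∈ Finset.univ) => hj0 F
  rw [energySq] at h
  have hG : gradForm v v = 0 := by linarith
  have hJ : ∑ F : T.facets, σ / facetDiam F * facetIntegral F (fun x => ‖jump o v F x‖ ^ 2) = 0 := by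
    linarith
  have hpart : ∀ K i j x, partialAt (v K i) j x = 0 := by
    intro K i j x
    rw [gradForm_self, Finset.sum_eq_zero_iff_of_nonneg fun K _ => Finset.sum_nonneg fun i _ =>
      Finset.sum_nonneg fun j _ => hg0 K i j] at hG
    have h1 := hG K (Finset.mem_univ _)
    rw [Finset.sum_eq_zero_iff_of_nonneg fun i _ => Finset.sum_nonneg fun j _ => hg0 K i j] at h1
    have h2 := h1 i (Finset.mem_univ _)
    rw [Finset.sum_eq_zero_iff_of_nonneg fun j _ => hg0 K i j] at h2
    have h3 := (cellIntegral_sq_eq_zero K (continuous_partialAt (v K i) j)).1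
      (h2 j (Finset.mem_univ _))
    have h4 := poly_eq_zero_of_ae_cell (partialPoly j (v K i)) K h3
    rw [← evalAt_partialPoly, h4]
    simp [evalAt]
  have hjump : ∀ F : T.facets, ∀ᵐ x ∂((Measure.euclideanHausdorffMeasure (d - 1)).restrict
      (hull F.1)), jump o v F x = 0 := by
    intro F
    have h1 := (Finset.sum_eq_zero_iff_of_nonneg fun F _ => hj0 F).1 hJ F (Finset.mem_univ _)
    have h2 := (mul_eq_zero.1 h1).resolve_left (div_pos hσ (facetDiam_pos hd F)).ne'
    rw [facetIntegral_sq_eq_zero (by omega) F (continuous_jump o v F).norm] at h2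
    simpa using h2
  have hcell : ∀ i, ∑ K : T.cells, cellIntegral K (fun x => evalAt (v K i) x ^ 2) = 0 := by
    intro i
    let l : Fin d := ⟨0, by omega⟩
    have hl : ContDiff ℝ 1 (fun x : EuclideanSpace ℝ (Fin d) => x l) := by fun_prop
    have hf : ∀ K : T.cells, ContDiff ℝ 1 (fun x => x l * evalAt (v K i) x ^ 2) := fun K =>
      hl.mul ((contDiff_evalAt (v K i)).pow 2)
    have h1 := sum_cellIntegral_fderiv (by omega) o (fun K x => x l * evalAt (v K i) x ^ 2) hf
      (EuclideanSpace.single l 1)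
    have h2 : ∀ (K : T.cells) x, fderiv ℝ (fun x => x l * evalAt (v K i) x ^ 2) x
        (EuclideanSpace.single l 1) = evalAt (v K i) x ^ 2 := by
      intro K x
      have hp := ((contDiff_evalAt (v K i) (n := 1)).differentiable one_ne_zero x)
      have hpp : DifferentiableAt ℝ (fun x => evalAt (v K i) x ^ 2) x := hp.pow 2
      have e2 : fderiv ℝ (fun x : EuclideanSpace ℝ (Fin d) => x l) x (EuclideanSpace.single l 1) = 1 := by
        have : HasFDerivAt (fun x : EuclideanSpace ℝ (Fin d) => x l)
          (EuclideanSpace.proj l : EuclideanSpace ℝ (Fin d) →L[ℝ] ℝ) x :=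
          (EuclideanSpace.proj l : EuclideanSpace ℝ (Fin d) →L[ℝ] ℝ).hasFDerivAt
        rw [this.fderiv]; simp
      rw [fderiv_fun_mul (hl.differentiable one_ne_zero x) hpp, fderiv_fun_pow 2 hp]
      simp only [add_apply, smul_apply, fderiv_evalAt_single, hpart, e2]
      simp
    simp only [h2] at h1
    rw [h1]
    refine Finset.sum_eq_zero fun F _ => ?_
    rw [facetIntegral, integral_eq_zero_of_ae, mul_zero]
    filter_upwards [hjump F] with x hx
    have h3 : evalAt (v (o.plus F) i) x =
        ∑ K ∈ (T.adjacent F).erase (o.plus F), evalAt (v K i) x := by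
      have h4 := jump_apply o v F x i
      rw [hx] at h4
      exact (sub_eq_zero.1 h4.symm)
    rw [Pi.zero_apply, ← Finset.mul_sum, ← mul_sub, h3, mul_eq_zero, sub_eq_zero]
    right
    have hcard := card_adjacent_erase_le_one (by omega) o F
    have : Nonempty T.cells := ⟨o.plus F⟩
    rcases Finset.card_le_one_iff_subset_singleton.1 hcard with ⟨L, hL⟩
    rcases Finset.subset_singleton_iff.1 hL with h5 | h5 <;> simp [h5]
  funext K i
  have h1 := (Finset.sum_eq_zero_iff_of_nonneg fun K _ =>
    cellIntegral_nonneg K fun x => sq_nonneg (evalAt (v K i) x)).1 (hcell i) K (Finset.mem_univ _)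
  exact poly_eq_zero_of_ae_cell _ K ((cellIntegral_sq_eq_zero K (continuous_evalAt _)).1 h1)

/-! ### Coercivity -/

theorem exists_le_mul_inner {W : Type*} [NormedAddCommGroup W] [InnerProductSpace ℝ W]
    [FiniteDimensional ℝ W] (B : W →ₗ[ℝ] W →ₗ[ℝ] ℝ) :
    ∃ C, 0 ≤ C ∧ ∀ x, B x x ≤ C * inner ℝ x x := by
  refine ⟨‖B.toContinuousBilinearMap‖, ContinuousLinearMap.opNorm_nonneg _, fun x => ?_⟩
  have h1 := B.toContinuousBilinearMap.le_opNorm₂ x x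
  rw [real_inner_self_eq_norm_mul_norm, ← mul_assoc]
  exact (le_abs_self _).trans h1

/-- On a finite-dimensional space a positive definite form dominates every bilinear form. -/
theorem exists_le_mul_of_posDef {W : Type*} [AddCommGroup W] [Module ℝ W] [FiniteDimensional ℝ W]
    (A B : W →ₗ[ℝ] W →ₗ[ℝ] ℝ) (hs : ∀ x y, A x y = A y x) (hn : ∀ x, 0 ≤ A x x)
    (hp : ∀ x, A x x = 0 → x = 0) : ∃ C, 0 ≤ C ∧ ∀ x, B x x ≤ C * A x x := by
  let c : InnerProductSpace.Core ℝ W :=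
    { inner := fun x y => A x y
      conj_inner_symm := fun x y => by simpa using hs y x
      re_inner_nonneg := fun x => by simpa using hn x
      add_left := fun x y z => by simp
      smul_left := fun x y r => by simp
      definite := hp }
  exact @exists_le_mul_inner W c.toNormedAddCommGroup (InnerProductSpace.ofCore c.toCore) _ B

theorem evalAt_add {m : ℕ} (p q : Poly d m) (x : EuclideanSpace ℝ (Fin d)) :
    evalAt (p + q) x = evalAt p x + evalAt q x := by simp [evalAt]

theorem evalAt_smul {m : ℕ} (c : ℝ) (p : Poly d m) (x : EuclideanSpace ℝ (Fin d)) :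
    evalAt (c • p) x = c * evalAt p x := by simp [evalAt]

/-- The form `(p, q) ↦ ∫_S p q dμ` on polynomials. -/
noncomputable def polyForm (m : ℕ) (μ : Measure (EuclideanSpace ℝ (Fin d)))
    (hμ : ∀ g : EuclideanSpace ℝ (Fin d) → ℝ, Continuous g → Integrable g μ) :
    Poly d m →ₗ[ℝ] Poly d m →ₗ[ℝ] ℝ :=
  LinearMap.mk₂ ℝ (fun p q => ∫ x, evalAt p x * evalAt q x ∂μ)
    (fun p p' q => by
      simp only [evalAt_add, add_mul]
      exact integral_add (hμ _ ((continuous_evalAt _).mul (continuous_evalAt _)))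
        (hμ _ ((continuous_evalAt _).mul (continuous_evalAt _))))
    (fun c p q => by simp only [evalAt_smul, mul_assoc]; exact integral_const_mul _ _)
    (fun p q q' => by
      simp only [evalAt_add, mul_add]
      exact integral_add (hμ _ ((continuous_evalAt _).mul (continuous_evalAt _)))
        (hμ _ ((continuous_evalAt _).mul (continuous_evalAt _))))
    (fun c p q => by simp only [evalAt_smul, mul_left_comm]; exact integral_const_mul _ _)

/-- The discrete trace inequality, with one constant for all cells and facets of the mesh. -/
theorem exists_trace_bound (hd : 1 ≤ d) (T : SimplicialMesh d Ω) (m : ℕ) : ∃ C, 0 ≤ C ∧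
    ∀ (F : T.facets) (K : T.cells) (p : Poly d m), facetIntegral F (fun x => evalAt p x ^ 2) ≤
      C * cellIntegral K (fun x => evalAt p x ^ 2) := by
  have h : ∀ (F : T.facets) (K : T.cells), ∃ C, 0 ≤ C ∧ ∀ p : Poly d m,
      facetIntegral F (fun x => evalAt p x ^ 2) ≤ C * cellIntegral K (fun x => evalAt p x ^ 2) := by
    intro F K
    obtain ⟨C, hC, hb⟩ := exists_le_mul_of_posDef
      (polyForm m (volume.restrict (hull K.1)) fun g hg => integrableOn_cell K hg)
      (polyForm m ((Measure.euclideanHausdorffMeasure (d - 1)).restrict (hull F.1))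
        fun g hg => integrableOn_facet hd F hg)
      (fun p q => by simp [polyForm, mul_comm])
      (fun p => integral_nonneg fun x => mul_self_nonneg _) (fun p hp => by
        refine poly_eq_zero_of_ae_cell p K ((cellIntegral_sq_eq_zero K (continuous_evalAt _)).1 ?_)
        simpa [polyForm, ← pow_two, cellIntegral] using hp)
    refine ⟨C, hC, fun p => ?_⟩
    simpa [polyForm, ← pow_two, cellIntegral, facetIntegral] using hb p
  choose C hC hb using h
  refine ⟨∑ F, ∑ K, C F K, Finset.sum_nonneg fun F _ => Finset.sum_nonneg fun K _ => hC F K,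
    fun F K p => (hb F K p).trans (mul_le_mul_of_nonneg_right ?_
      (cellIntegral_nonneg K fun x => sq_nonneg _))⟩
  exact (Finset.single_le_sum (f := fun K => C F K) (fun K _ => hC F K) (Finset.mem_univ K)).trans
    (Finset.single_le_sum (f := fun F => ∑ K, C F K)
      (fun F _ => Finset.sum_nonneg fun K _ => hC F K) (Finset.mem_univ F))

theorem average_sq_le (F : T.facets) (φ : T.cells → ℝ) :
    average F φ ^ 2 ≤ ∑ K ∈ T.adjacent F, φ K ^ 2 := by
  have h1 := sq_sum_le_card_mul_sum_sq (s := T.adjacent F) (f := φ)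
  rw [average, mul_pow]
  rcases (T.adjacent F).eq_empty_or_nonempty with h | h
  · simp [h]
  · have hc : (1 : ℝ) ≤ (T.adjacent F).card := by exact_mod_cast h.card_pos
    have hS : 0 ≤ ∑ K ∈ T.adjacent F, φ K ^ 2 := Finset.sum_nonneg fun K _ => sq_nonneg _
    rw [inv_pow, inv_mul_le_iff₀ (by positivity)]
    refine h1.trans (mul_le_mul_of_nonneg_right ?_ hS)
    nlinarith

theorem avgGradNormalJump_le (o : FacetOrientation T) (v : VelSpace T k) (F : T.facets)
    {δ : ℝ} (hδ : 0 < δ) (x : EuclideanSpace ℝ (Fin d)) :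
    avgGradNormalJump o v v F x ≤
      δ * ∑ K ∈ T.adjacent F, ∑ i, ∑ j, partialAt (v K i) j x ^ 2 +
        d / (4 * δ) * ‖jump o v F x‖ ^ 2 := by
  have hn : ∀ j, o.normal F j ^ 2 ≤ 1 := fun j => by
    have h1 := EuclideanSpace.norm_sq_eq (o.normal F)
    rw [o.norm_normal] at h1
    have h2 : ‖o.normal F j‖ ^ 2 ≤ ∑ i, ‖o.normal F i‖ ^ 2 :=
      Finset.single_le_sum (f := fun i => ‖o.normal F i‖ ^ 2) (fun i _ => sq_nonneg _)
        (Finset.mem_univ j)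
    rw [Real.norm_eq_abs, sq_abs] at h2
    linarith
  have hterm : ∀ i j, average F (fun K => partialAt (v K i) j x) * o.normal F j * jump o v F x i ≤
      δ * ∑ K ∈ T.adjacent F, partialAt (v K i) j x ^ 2 + (jump o v F x i) ^ 2 / (4 * δ) := by
    intro i j
    set g := average F (fun K => partialAt (v K i) j x)
    set w := jump o v F x i
    have h1 := average_sq_le F (fun K => partialAt (v K i) j x)
    have h2 : g * o.normal F j * w ≤ δ * (g * o.normal F j) ^ 2 + w ^ 2 / (4 * δ) := by
      have h3 : δ * (g * o.normal F j) ^ 2 + w ^ 2 / (4 * δ) - g * o.normal F j * w =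
          (2 * δ * (g * o.normal F j) - w) ^ 2 / (4 * δ) := by
        field_simp
        ring
      have h4 : 0 ≤ (2 * δ * (g * o.normal F j) - w) ^ 2 / (4 * δ) := by positivity
      linarith
    have h5 : (g * o.normal F j) ^ 2 ≤ g ^ 2 := by
      rw [mul_pow]
      exact mul_le_of_le_one_right (sq_nonneg _) (hn j)
    have h6 : δ * (g * o.normal F j) ^ 2 ≤ δ * ∑ K ∈ T.adjacent F, partialAt (v K i) j x ^ 2 :=
      mul_le_mul_of_nonneg_left (h5.trans h1) hδ.le
    linarith
  refine (Finset.sum_le_sum fun i _ => Finset.sum_le_sum fun j _ => hterm i j).trans (le_of_eq ?_)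
  simp only [Finset.sum_add_distrib, ← Finset.mul_sum, Finset.sum_const, Finset.card_univ,
    Fintype.card_fin, nsmul_eq_mul]
  congr 1
  · congr 1
    rw [Finset.sum_comm' (t' := Finset.univ) (s' := fun _ => T.adjacent F) (by simp)]
    refine Finset.sum_congr rfl fun i _ => ?_
    rw [Finset.sum_comm]
  · rw [← Finset.sum_div, EuclideanSpace.norm_sq_eq]
    simp only [Real.norm_eq_abs, sq_abs]
    ring

theorem continuous_avgGradNormalJump (o : FacetOrientation T) (w v : VelSpace T k) (F : T.facets) :
    Continuous (avgGradNormalJump o w v F) := by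
  refine continuous_finsetSum _ fun i _ => continuous_finsetSum _ fun j _ => ?_
  refine ((continuous_average F fun K => continuous_partialAt (w K i) j).mul continuous_const).mul ?_
  have := continuous_jump o v F
  fun_prop

/-- Coercivity for large penalty: the consistency terms are absorbed by Young's inequality and the
discrete trace inequality. -/
theorem exists_isCoercive (hd : 2 ≤ d) (o : FacetOrientation T) (k : ℕ) :
    ∃ σ₀ : ℝ, ∀ σ ≥ σ₀, IsCoercive o k σ := by
  obtain ⟨C, hC, htr⟩ := exists_trace_bound (by omega) T k
  set N : ℝ := ((Fintype.card T.facets : ℕ) : ℝ)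
  have hN0 : 0 ≤ N := Nat.cast_nonneg _
  -- `δ` is the Young parameter; it leaves at least half of the gradient term
  set δ : ℝ := 1 / (4 * (N * C + 1)) with hδd
  have hδ : 0 < δ := by positivity
  have hδN : 2 * δ * (N * C) ≤ 1 / 2 := by
    rw [hδd]
    have : 0 ≤ N * C := mul_nonneg hN0 hC
    rw [show 2 * (1 / (4 * (N * C + 1))) * (N * C) = (N * C) / (2 * (N * C + 1)) by
      field_simp; ring, div_le_div_iff₀ (by positivity) (by norm_num)]
    linarith
  refine ⟨∑ F : T.facets, d * facetDiam F / δ, fun σ hσ => ⟨1 / 2, by norm_num, fun v => ?_⟩⟩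
  have hG := gradForm_self v
  have hX : ∀ F : T.facets, facetIntegral F (avgGradNormalJump o v v F) ≤
      δ * (C * gradForm v v) + d / (4 * δ) * facetIntegral F (fun x => ‖jump o v F x‖ ^ 2) := by
    intro F
    have c1 : ∀ K i j, Continuous fun x => partialAt (v K i) j x ^ 2 := fun K i j =>
      (continuous_partialAt _ _).pow 2
    have c2 : Continuous fun x => ‖jump o v F x‖ ^ 2 := (continuous_jump o v F).norm.pow 2
    have h1 : facetIntegral F (avgGradNormalJump o v v F) ≤ facetIntegral F (fun x =>
        δ * ∑ K ∈ T.adjacent F, ∑ i, ∑ j, partialAt (v K i) j x ^ 2 +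
        d / (4 * δ) * ‖jump o v F x‖ ^ 2) := by
      refine integral_mono (integrableOn_facet (by omega) F (continuous_avgGradNormalJump o v v F))
        (integrableOn_facet (by omega) F ?_) fun x => avgGradNormalJump_le o v F hδ x
      fun_prop
    have h2 : facetIntegral F (fun x =>
        δ * ∑ K ∈ T.adjacent F, ∑ i, ∑ j, partialAt (v K i) j x ^ 2 +
        d / (4 * δ) * ‖jump o v F x‖ ^ 2) =
        δ * ∑ K ∈ T.adjacent F, ∑ i, ∑ j, facetIntegral F (fun x => partialAt (v K i) j x ^ 2) +
        d / (4 * δ) * facetIntegral F (fun x => ‖jump o v F x‖ ^ 2) := by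
      unfold facetIntegral
      have I : ∀ {g : EuclideanSpace ℝ (Fin d) → ℝ}, Continuous g → Integrable g
          ((Measure.euclideanHausdorffMeasure (d - 1)).restrict (hull F.1)) :=
        fun hg => integrableOn_facet (by omega) F hg
      rw [integral_add (I (by fun_prop)) (I (by fun_prop)), integral_const_mul, integral_const_mul,
        integral_finsetSum _ fun K _ => I (by fun_prop)]
      congr 2
      refine Finset.sum_congr rfl fun K _ => ?_
      rw [integral_finsetSum _ fun i _ => I (by fun_prop)]
      refine Finset.sum_congr rfl fun i _ => ?_
      rw [integral_finsetSum _ fun j _ => I (by fun_prop)]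
    have h3 : ∑ K ∈ T.adjacent F, ∑ i, ∑ j, facetIntegral F (fun x => partialAt (v K i) j x ^ 2) ≤
        C * gradForm v v := by
      rw [hG, Finset.mul_sum]
      refine (Finset.sum_le_sum_of_subset_of_nonneg (Finset.subset_univ _) fun K _ _ =>
        Finset.sum_nonneg fun i _ => Finset.sum_nonneg fun j _ =>
          facetIntegral_nonneg F fun x => sq_nonneg _).trans (Finset.sum_le_sum fun K _ => ?_)
      simp only [Finset.mul_sum]
      exact Finset.sum_le_sum fun i _ => Finset.sum_le_sum fun j _ =>
        htr F K (partialPoly j (v K i))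
    rw [h2] at h1
    exact h1.trans (add_le_add_left (mul_le_mul_of_nonneg_left h3 hδ.le) _)
  have hsum := Finset.sum_le_sum fun (F : T.facets) (_ : F ∈ Finset.univ) => hX F
  rw [Finset.sum_add_distrib, Finset.sum_const, Finset.card_univ, nsmul_eq_mul] at hsum
  have hpen : 2 * ∑ F : T.facets, d / (4 * δ) * facetIntegral F (fun x => ‖jump o v F x‖ ^ 2) ≤
      1 / 2 * ∑ F : T.facets, σ / facetDiam F * facetIntegral F (fun x => ‖jump o v F x‖ ^ 2) := by
    rw [Finset.mul_sum, Finset.mul_sum]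
    refine Finset.sum_le_sum fun F _ => ?_
    rw [← mul_assoc, ← mul_assoc]
    refine mul_le_mul_of_nonneg_right ?_ (facetIntegral_nonneg F fun x => sq_nonneg _)
    have hF := facetDiam_pos hd F
    have h1 : d * facetDiam F / δ ≤ σ := le_trans (Finset.single_le_sum
      (f := fun F : T.facets => d * facetDiam F / δ)
      (fun F _ => div_nonneg (mul_nonneg (Nat.cast_nonneg _) (facetDiam_pos hd F).le) hδ.le)
      (Finset.mem_univ F)) hσ
    have h2 : (d : ℝ) / δ ≤ σ / facetDiam F := by
      rw [le_div_iff₀ hF]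
      calc (d : ℝ) / δ * facetDiam F = d * facetDiam F / δ := by ring
        _ ≤ σ := h1
    calc 2 * ((d : ℝ) / (4 * δ)) = 1 / 2 * (d / δ) := by field_simp; ring
      _ ≤ 1 / 2 * (σ / facetDiam F) := by linarith
  have hG0 : 0 ≤ gradForm v v := by
    rw [hG]
    exact Finset.sum_nonneg fun K _ => Finset.sum_nonneg fun i _ => Finset.sum_nonneg fun j _ =>
      cellIntegral_nonneg K fun x => sq_nonneg _
  have hGN : 2 * (N * (δ * (C * gradForm v v))) ≤ 1 / 2 * gradForm v v := by
    calc 2 * (N * (δ * (C * gradForm v v))) = 2 * δ * (N * C) * gradForm v v := by ring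
      _ ≤ 1 / 2 * gradForm v v := mul_le_mul_of_nonneg_right hδN hG0
  unfold energySq aForm
  simp only [real_inner_self_eq_norm_sq]
  linarith

/-! ### Linearity and the normal-jump seminorm -/

theorem partialAt_smul_add {m : ℕ} (c : ℝ) (p q : Poly d m) (j : Fin d)
    (x : EuclideanSpace ℝ (Fin d)) :
    partialAt (c • p + q) j x = c * partialAt p j x + partialAt q j x := by
  simp [partialAt]

theorem localDiv_smul_add (c : ℝ) (v w : VelSpace T k) (K : T.cells) (x : EuclideanSpace ℝ (Fin d)) :
    localDiv (c • v + w) K x = c * localDiv v K x + localDiv w K x := by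
  simp only [localDiv, Pi.add_apply, Pi.smul_apply, partialAt_smul_add, Finset.sum_add_distrib,
    Finset.mul_sum]

theorem localVal_smul_add (c : ℝ) (v w : VelSpace T k) (K : T.cells)
    (x : EuclideanSpace ℝ (Fin d)) :
    localVal (c • v + w) K x = c • localVal v K x + localVal w K x := by
  ext i
  simp [localVal, evalAt]

theorem jump_smul_add (o : FacetOrientation T) (c : ℝ) (v w : VelSpace T k) (F : T.facets)
    (x : EuclideanSpace ℝ (Fin d)) :
    jump o (c • v + w) F x = c • jump o v F x + jump o w F x := by
  simp only [jump, localVal_smul_add, Finset.sum_add_distrib, ← Finset.smul_sum]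
  module

theorem normalJump_smul_add (o : FacetOrientation T) (c : ℝ) (v w : VelSpace T k) (F : T.facets)
    (x : EuclideanSpace ℝ (Fin d)) :
    normalJump o (c • v + w) F x = c * normalJump o v F x + normalJump o w F x := by
  simp only [normalJump, jump_smul_add, inner_add_left, real_inner_smul_left]

theorem average_smul_add (F : T.facets) (c : ℝ) (φ ψ : T.cells → ℝ) :
    average F (fun K => c * φ K + ψ K) = c * average F φ + average F ψ := by
  simp only [average, Finset.sum_add_distrib, ← Finset.mul_sum]
  ring

theorem avgGradNormalJump_smul_add_left (o : FacetOrientation T) (c : ℝ) (v w u : VelSpace T k)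
    (F : T.facets) (x : EuclideanSpace ℝ (Fin d)) :
    avgGradNormalJump o (c • v + w) u F x =
      c * avgGradNormalJump o v u F x + avgGradNormalJump o w u F x := by
  simp only [avgGradNormalJump, Pi.add_apply, Pi.smul_apply, partialAt_smul_add, average_smul_add,
    add_mul, Finset.sum_add_distrib, Finset.mul_sum, mul_assoc]

theorem avgGradNormalJump_smul_add_right (o : FacetOrientation T) (c : ℝ) (v w u : VelSpace T k)
    (F : T.facets) (x : EuclideanSpace ℝ (Fin d)) :
    avgGradNormalJump o u (c • v + w) F x =
      c * avgGradNormalJump o u v F x + avgGradNormalJump o u w F x := by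
  simp only [avgGradNormalJump, jump_smul_add, PiLp.add_apply, PiLp.smul_apply, smul_eq_mul,
    mul_add, Finset.sum_add_distrib, Finset.mul_sum]
  congr 1
  exact Finset.sum_congr rfl fun i _ => Finset.sum_congr rfl fun j _ => by ring

theorem cellIntegral_mul_add (K : T.cells) (c : ℝ) {g h : EuclideanSpace ℝ (Fin d) → ℝ}
    (hg : Continuous g) (hh : Continuous h) :
    cellIntegral K (fun x => c * g x + h x) = c * cellIntegral K g + cellIntegral K h := by
  unfold cellIntegral
  rw [integral_add ((integrableOn_cell K hg).const_mul c) (integrableOn_cell K hh),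
    integral_const_mul]

theorem facetIntegral_mul_add (hd : 1 ≤ d) (F : T.facets) (c : ℝ)
    {g h : EuclideanSpace ℝ (Fin d) → ℝ} (hg : Continuous g) (hh : Continuous h) :
    facetIntegral F (fun x => c * g x + h x) = c * facetIntegral F g + facetIntegral F h := by
  unfold facetIntegral
  rw [integral_add ((integrableOn_facet hd F hg).const_mul c) (integrableOn_facet hd F hh),
    integral_const_mul]

theorem bForm_smul_add (hd : 1 ≤ d) (o : FacetOrientation T) (c : ℝ) (v w : VelSpace T k)
    (q : ScalarSpace T (k - 1)) : bForm o (c • v + w) q = c * bForm o v q + bForm o w q := by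
  have h1 : ∀ K : T.cells, (cellIntegral K fun x => evalAt (q K) x * localDiv (c • v + w) K x) =
      c * (cellIntegral K fun x => evalAt (q K) x * localDiv v K x) +
        cellIntegral K fun x => evalAt (q K) x * localDiv w K x := fun K => by
    rw [← cellIntegral_mul_add K c (g := fun x => evalAt (q K) x * localDiv v K x)
      (h := fun x => evalAt (q K) x * localDiv w K x)
      ((continuous_evalAt _).mul (continuous_localDiv v K))
      ((continuous_evalAt _).mul (continuous_localDiv w K))]
    congr 1; ext x
    rw [localDiv_smul_add]; ring
  have h2 : ∀ F : T.facets, (facetIntegral F fun x =>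
        average F (fun K => evalAt (q K) x) * normalJump o (c • v + w) F x) =
      c * (facetIntegral F fun x => average F (fun K => evalAt (q K) x) * normalJump o v F x) +
        facetIntegral F fun x => average F (fun K => evalAt (q K) x) * normalJump o w F x :=
    fun F => by
    have ha := continuous_average F fun K => continuous_evalAt (q K)
    rw [← facetIntegral_mul_add hd F c
      (g := fun x => average F (fun K => evalAt (q K) x) * normalJump o v F x)
      (h := fun x => average F (fun K => evalAt (q K) x) * normalJump o w F x)
      (ha.mul (continuous_normalJump o v F))
      (ha.mul (continuous_normalJump o w F))]
    congr 1; ext x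
    rw [normalJump_smul_add]; ring
  simp only [bForm, h1, h2, Finset.sum_add_distrib, ← Finset.mul_sum]
  ring

theorem gradForm_smul_add (c : ℝ) (v w u : VelSpace T k) :
    gradForm (c • v + w) u = c * gradForm v u + gradForm w u := by
  simp only [gradForm, Finset.mul_sum, ← Finset.sum_add_distrib]
  refine Finset.sum_congr rfl fun K _ => ?_
  have hc : ∀ v' : VelSpace T k, Continuous fun x =>
      ∑ i, ∑ j, partialAt (v' K i) j x * partialAt (u K i) j x := fun v' =>
    continuous_finsetSum _ fun i _ => continuous_finsetSum _ fun j _ =>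
      (continuous_partialAt _ _).mul (continuous_partialAt _ _)
  rw [← cellIntegral_mul_add K c (hc v) (hc w)]
  congr 1; ext x
  simp only [Pi.add_apply, Pi.smul_apply, partialAt_smul_add, add_mul, Finset.sum_add_distrib,
    Finset.mul_sum, mul_assoc]

theorem aForm_smul_add (hd : 1 ≤ d) (o : FacetOrientation T) (σ c : ℝ) (v w u : VelSpace T k) :
    aForm o σ (c • v + w) u = c * aForm o σ v u + aForm o σ w u := by
  have h1 : ∀ F : T.facets,
      facetIntegral F (fun x => inner ℝ (jump o (c • v + w) F x) (jump o u F x)) =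
        c * facetIntegral F (fun x => inner ℝ (jump o v F x) (jump o u F x)) +
          facetIntegral F (fun x => inner ℝ (jump o w F x) (jump o u F x)) := fun F => by
    rw [← facetIntegral_mul_add hd F c ((continuous_jump o v F).inner (continuous_jump o u F))
      ((continuous_jump o w F).inner (continuous_jump o u F))]
    simp only [jump_smul_add, inner_add_left, real_inner_smul_left]
  have h2 : ∀ F : T.facets, facetIntegral F (avgGradNormalJump o (c • v + w) u F) =
      c * facetIntegral F (avgGradNormalJump o v u F) +
        facetIntegral F (avgGradNormalJump o w u F) := fun F => by
    rw [← facetIntegral_mul_add hd F c (continuous_avgGradNormalJump o v u F)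
      (continuous_avgGradNormalJump o w u F)]
    congr 1; ext x
    exact avgGradNormalJump_smul_add_left o c v w u F x
  have h3 : ∀ F : T.facets, facetIntegral F (avgGradNormalJump o u (c • v + w) F) =
      c * facetIntegral F (avgGradNormalJump o u v F) +
        facetIntegral F (avgGradNormalJump o u w F) := fun F => by
    rw [← facetIntegral_mul_add hd F c (continuous_avgGradNormalJump o u v F)
      (continuous_avgGradNormalJump o u w F)]
    congr 1; ext x
    exact avgGradNormalJump_smul_add_right o c v w u F x
  simp only [aForm, gradForm_smul_add, h1, h2, h3, mul_add, Finset.sum_add_distrib,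
    mul_left_comm _ c, ← Finset.mul_sum]
  ring

theorem bForm_zero (hd : 1 ≤ d) (o : FacetOrientation T) (q : ScalarSpace T (k - 1)) :
    bForm o (0 : VelSpace T k) q = 0 := by
  have := bForm_smul_add hd o 1 (0 : VelSpace T k) 0 q
  simp only [smul_zero, add_zero] at this
  linarith

theorem aForm_zero (hd : 1 ≤ d) (o : FacetOrientation T) (σ : ℝ) (u : VelSpace T k) :
    aForm o σ (0 : VelSpace T k) u = 0 := by
  have := aForm_smul_add hd o σ 1 (0 : VelSpace T k) 0 u
  simp only [smul_zero, add_zero] at this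
  linarith

/-- `R_h^⊥` as a linear subspace of `V_h`. -/
noncomputable def rPerpSubmodule (hd : 1 ≤ d) (o : FacetOrientation T) (k : ℕ) (σ : ℝ) :
    Submodule ℝ (VelSpace T k) where
  carrier := RPerp o k σ
  zero_mem' := ⟨fun q _ => bForm_zero hd o q, fun u _ => aForm_zero hd o σ u⟩
  add_mem' {v w} hv hw := by
    refine ⟨fun q hq => ?_, fun u hu => ?_⟩
    · have := bForm_smul_add hd o 1 v w q
      rwa [one_smul, hv.1 q hq, hw.1 q hq, mul_zero, add_zero] at this
    · have := aForm_smul_add hd o σ 1 v w u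
      rwa [one_smul, hv.2 u hu, hw.2 u hu, mul_zero, add_zero] at this
  smul_mem' c v hv := by
    refine ⟨fun q hq => ?_, fun u hu => ?_⟩
    · have h := bForm_smul_add hd o c v 0 q
      rwa [hv.1 q hq, bForm_zero hd, mul_zero, add_zero, add_zero] at h
    · have h := aForm_smul_add hd o σ c v 0 u
      rwa [hv.2 u hu, aForm_zero hd, mul_zero, add_zero, add_zero] at h

/-- The bilinear form `∑_F h_F⁻¹ ∫_F (⟦v⟧ · n_F) (⟦w⟧ · n_F) ds`. -/
noncomputable def njForm (hd : 1 ≤ d) (o : FacetOrientation T) (k : ℕ) :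
    LinearMap.BilinForm ℝ (VelSpace T k) :=
  have key : ∀ (c : ℝ) (v w u : VelSpace T k),
      ∑ F : T.facets, 1 / facetDiam F *
          facetIntegral F (fun x => normalJump o (c • v + w) F x * normalJump o u F x) =
        c * ∑ F : T.facets, 1 / facetDiam F *
          facetIntegral F (fun x => normalJump o v F x * normalJump o u F x) +
        ∑ F : T.facets, 1 / facetDiam F *
          facetIntegral F (fun x => normalJump o w F x * normalJump o u F x) := fun c v w u => by
    rw [Finset.mul_sum, ← Finset.sum_add_distrib]
    refine Finset.sum_congr rfl fun F _ => ?_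
    rw [mul_left_comm, ← mul_add, ← facetIntegral_mul_add hd F c
      (g := fun x => normalJump o v F x * normalJump o u F x)
      (h := fun x => normalJump o w F x * normalJump o u F x)
      ((continuous_normalJump o v F).mul (continuous_normalJump o u F))
      ((continuous_normalJump o w F).mul (continuous_normalJump o u F))]
    simp only [normalJump_smul_add, add_mul, mul_assoc]
  have hadd := fun v w u => by simpa only [one_smul, one_mul] using key 1 v w u
  have h0 : ∀ u : VelSpace T k, ∑ F : T.facets, 1 / facetDiam F * facetIntegral F (fun x =>
      normalJump o (0 : VelSpace T k) F x * normalJump o u F x) = 0 := fun u => by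
    simpa using hadd 0 0 u
  have hsmul := fun c v u => by simpa only [add_zero, h0, smul_eq_mul] using key c v 0 u
  LinearMap.mk₂ ℝ (fun v w => ∑ F : T.facets, 1 / facetDiam F *
      facetIntegral F (fun x => normalJump o v F x * normalJump o w F x))
    hadd hsmul
    (fun v w u => by simpa only [mul_comm (normalJump o v _ _)] using hadd w u v)
    (fun c v w => by simpa only [mul_comm (normalJump o v _ _)] using hsmul c w v)

theorem njForm_apply (hd : 1 ≤ d) (o : FacetOrientation T) (v w : VelSpace T k) :
    njForm hd o k v w = ∑ F : T.facets, 1 / facetDiam F *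
      facetIntegral F (fun x => normalJump o v F x * normalJump o w F x) := rfl

theorem njForm_comm (hd : 1 ≤ d) (o : FacetOrientation T) (v w : VelSpace T k) :
    njForm hd o k v w = njForm hd o k w v := by
  simp only [njForm_apply, mul_comm (normalJump o v _ _)]

theorem njForm_self_nonneg (hd : 1 ≤ d) (o : FacetOrientation T) (v : VelSpace T k) :
    0 ≤ njForm hd o k v v :=
  Finset.sum_nonneg fun _ _ => mul_nonneg (one_div_nonneg.2 Metric.diam_nonneg)
    (facetIntegral_nonneg _ fun _ => mul_self_nonneg _)

theorem njNorm_eq (hd : 1 ≤ d) (o : FacetOrientation T) (v : VelSpace T k) :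
    njNorm o v = Real.sqrt (njForm hd o k v v) := by
  simp only [njNorm, njForm_apply, pow_two]

/-- The normal-jump seminorm on `V_h`. -/
noncomputable def njSeminorm (hd : 1 ≤ d) (o : FacetOrientation T) (k : ℕ) :
    Seminorm ℝ (VelSpace T k) :=
  Seminorm.of (njNorm o)
    (fun v w => by
      have hv := njForm_self_nonneg hd o v
      have hw := njForm_self_nonneg hd o w
      have hcs := (njForm hd o k).apply_mul_apply_le_of_forall_zero_le
        (njForm_self_nonneg hd o) v w
      rw [njForm_comm hd o w v] at hcs
      have hle : njForm hd o k v w ≤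
          Real.sqrt (njForm hd o k v v) * Real.sqrt (njForm hd o k w w) := by
        rw [← Real.sqrt_mul hv]
        exact Real.le_sqrt_of_sq_le (by rw [pow_two]; exact hcs)
      simp only [njNorm_eq hd]
      rw [Real.sqrt_le_left (by positivity), add_sq, Real.sq_sqrt hv, Real.sq_sqrt hw]
      simp only [map_add, LinearMap.add_apply]
      rw [njForm_comm hd o w v]
      linarith)
    (fun c v => by
      simp only [njNorm_eq hd, map_smul, LinearMap.smul_apply, smul_eq_mul]
      rw [← mul_assoc, Real.sqrt_mul (mul_self_nonneg c), Real.sqrt_mul_self_eq_abs,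
        Real.norm_eq_abs])

/-! ### Fields without normal jumps in `R_h^⊥` -/

theorem normalContinuous_of_njNorm_eq_zero (hd : 2 ≤ d) (o : FacetOrientation T) (v : VelSpace T k)
    (h : njNorm o v = 0) : NormalContinuous o v := by
  intro F
  have h0 : ∀ F : T.facets, 0 ≤ 1 / facetDiam F * facetIntegral F (fun x => normalJump o v F x ^ 2) :=
    fun F => mul_nonneg (one_div_nonneg.2 Metric.diam_nonneg)
      (facetIntegral_nonneg _ fun _ => sq_nonneg _)
  rw [njNorm, Real.sqrt_eq_zero (Finset.sum_nonneg fun F _ => h0 F),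
    Finset.sum_eq_zero_iff_of_nonneg fun F _ => h0 F] at h
  have h1 := (mul_eq_zero.1 (h F (Finset.mem_univ _))).resolve_left
    (one_div_pos.2 (facetDiam_pos hd F)).ne'
  exact (facetIntegral_sq_eq_zero (by omega) F (continuous_normalJump o v F)).1 h1

/-- An element of `R_h^⊥` without normal jumps lies in `W_h^div`, so it is `a_h`-orthogonal to
itself. -/
theorem eq_zero_of_normalContinuous (hd : 2 ≤ d) (hΩ : interior (closure Ω) = Ω)
    {o : FacetOrientation T} {σ : ℝ} (hσ : 0 < σ) (hc : IsCoercive o k σ) {v : VelSpace T k}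
    (hv : v ∈ RPerp o k σ) (h : NormalContinuous o v) : v = 0 := by
  obtain ⟨C, hC, hcoer⟩ := hc
  have h1 := hv.2 v (h.mem_WDiv (by omega) hΩ hv.1)
  have h2 := hcoer v
  rw [h1] at h2
  have h3 : energySq o σ v ≤ 0 := nonpos_of_mul_nonpos_right h2 hC
  have h4 : 0 ≤ energySq o σ v := by
    refine add_nonneg ?_ (Finset.sum_nonneg fun F _ =>
      mul_nonneg (div_nonneg hσ.le Metric.diam_nonneg) (facetIntegral_nonneg F fun x => sq_nonneg _))
    rw [gradForm_self]
    exact Finset.sum_nonneg fun K _ => Finset.sum_nonneg fun i _ => Finset.sum_nonneg fun j _ =>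
      cellIntegral_nonneg K fun x => sq_nonneg _
  exact eq_zero_of_energySq_eq_zero hd o hσ v (le_antisymm h3 h4)

end DGStokes

theorem corollary3p7 (d : ℕ) (hd : d = 2 ∨ d = 3) (Ω : Set (EuclideanSpace ℝ (Fin d)))
    (hΩ_open : IsOpen Ω) (hΩ_conn : IsConnected Ω) (hΩ_reg : interior (closure Ω) = Ω)
    (T : DGStokes.SimplicialMesh d Ω) (o : DGStokes.FacetOrientation T)
    (k : ℕ) (hk : 1 ≤ k) :
    (∃ σ₀ : ℝ, ∀ σ ≥ σ₀, DGStokes.IsCoercive o k σ) ∧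
    ∀ σ : ℝ, 1 ≤ σ → DGStokes.IsCoercive o k σ →
      (∃ R : Submodule ℝ (DGStokes.VelSpace T k),
        (R : Set (DGStokes.VelSpace T k)) = DGStokes.RPerp o k σ ∧
        ∃ p : Seminorm ℝ R, (∀ v : R, p v = DGStokes.njNorm o v.1) ∧ ∀ v : R, p v = 0 → v = 0) ∧
      ∀ v ∈ DGStokes.RPerp o k σ, DGStokes.velFun v ∈ DGStokes.HZeroDiv Ω → v = 0 := by
  have hd2 : 2 ≤ d := by omega
  have hd1 : 1 ≤ d := by omega
  refine ⟨DGStokes.exists_isCoercive hd2 o k, fun σ hσ hc => ⟨?_, fun v hv hdiv => ?_⟩⟩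
  · refine ⟨DGStokes.rPerpSubmodule hd1 o k σ, rfl,
      (DGStokes.njSeminorm hd1 o k).comp (Submodule.subtype _), fun v => rfl, fun v hv => ?_⟩
    exact Subtype.ext (DGStokes.eq_zero_of_normalContinuous hd2 hΩ_reg (by linarith) hc v.2
      (DGStokes.normalContinuous_of_njNorm_eq_zero hd2 o v.1 hv))
  · exact DGStokes.eq_zero_of_normalContinuous hd2 hΩ_reg (by linarith) hc hv
      (DGStokes.normalContinuous_of_mem_HZeroDiv hd1 hΩ_reg hΩ_open o v hdiv)
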